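/- Fix an integer $d\ge 2$. **Loops.** Let $E$ be the set of directed nearest-neighbour edges $e=(u(e),v(e))$ of $\mathbb Z^d$, $e^{-1}$ the reversed edge, and $E^+$ the set of edges with $v(e)>u(e)$ in the lexicographic order. A closed path is a sequence $e_1\cdots e_n$ of edges ($n=0$ allowed) with $v(e_i)=u(e_{i+1})$, indices mod $n$; it has a backtrack at $i$ if $e_{i+1}=e_i^{-1}$, indices mod $n$. A loop is a class, modulo cyclic rotation, of closed paths without backtracks; the empty one is the null loop $\emptyset$. The core $[\rho]$ of a closed path $\rho$ is the loop obtained from $\rho$ by successively erasing backtracks (it is unique). A loop sequence is a finite sequence of loops modulo insertion and deletion of null loops; $\mathcal S$ is the set of loop sequences, and the minimal representation of $s\in\mathcal S$ is its representative $(l_1,\ldots,l_n)$ without null loops; $|s|:=|l_1|+\cdots+|l_n|$ is the total number of edges; the null loop sequence $\emptyset$ has $|\emptyset|=0$. Let $\mathcal P^+$ be the set of closed paths $p=e_1e_2e_3e_4$ without backtracks such that $u(e_1)$ is the lexicographically smallest and $v(e_1)$ the second smallest vertex of $p$; $\mathcal P^+(e)$ is the set of $p\in\mathcal P^+$ containing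 $e$ or $e^{-1}$. **Operations.** Fix a rule that chooses a first edge of every non-null loop; then the loop is written as a path and its edges are numbered by locations. For locations $x<y$ of $l$: if $l=aebec$ with $e$ at $x$ and $y$, put $\times^1_{x,y}l=[aec]$, $\times^2_{x,y}l=[be]$; if $l=aebe^{-1}c$ with $e$ at $x$ and $e^{-1}$ at $y$, put $\times^1_{x,y}l=[ac]$, $\times^2_{x,y}l=[b]$; in both cases $\times^1_{y,x}l=\times^2_{x,y}l$ and $\times^2_{y,x}l=\times^1_{x,y}l$. If $l=aeb$ with $e$ at $x$ and $p\in\mathcal P^+(e)$, put $l\oplus_xp=[aedceb]$, $l\ominus_xp=[ac^{-1}d^{-1}b]$ when $p=ced$, and $l\oplus_xp=[aec^{-1}d^{-1}eb]$, $l\ominus_xp=[adcb]$ when $p=ce^{-1}d$. **Limiting master loop equation.** A function $\phi:\mathcal S\to\mathbb R$ satisfies it at $\beta\in\mathbb R$ if for every non-null loop sequence $s$ with minimal representation $(l_1,\ldots,l_n)$, with $e$ the first edge of $l_1$, $A$ and $B$ the sets of locations in $l_1$ of $e$ and of $e^{-1}$, $C=A\cup B$, and $m=|C|$, $$\begin{aligned}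 m\,\phi(s)={}&\sum_{x\in A,\,y\in B}\phi(\times^1_{x,y}l_1,\times^2_{x,y}l_1,l_2,\ldots,l_n)+\sum_{x\in B,\,y\in A}\phi(\times^1_{x,y}l_1,\times^2_{x,y}l_1,l_2,\ldots,l_n)\\&-\sum_{\substack{x,y\in A\\x\ne y}}\phi(\times^1_{x,y}l_1,\times^2_{x,y}l_1,l_2,\ldots,l_n)-\sum_{\substack{x,y\in B\\x\ne y}}\phi(\times^1_{x,y}l_1,\times^2_{x,y}l_1,l_2,\ldots,l_n)\\&+\beta\sum_{p\in\mathcal P^+(e)}\sum_{x\in C}\phi(l_1\ominus_xp,l_2,\ldots,l_n)-\beta\sum_{p\in\mathcal P^+(e)}\sum_{x\in C}\phi(l_1\oplus_xp,l_2,\ldots,l_n).\end{aligned}$$ **Gauge theory.** For a finite $\Lambda\subseteq\mathbb Z^d$, let $E^+_\Lambda$ and $\mathcal P^+_\Lambda$ be the elements of $E^+$ and $\mathcal P^+$ with all vertices in $\Lambda$. Let $\mu_{\Lambda,N,\beta}$ be the probability measure on $SO(N)^{E^+_\Lambda}$ with density proportional to $\exp\bigl(N\beta\sum_{p\in\mathcal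 P^+_\Lambda}W_p\bigr)$ with respect to the product of the Haar probability measures, where $W_{e_1\cdots e_k}=\operatorname{Tr}(Q_{e_1}\cdots Q_{e_k})$ and $Q_{e^{-1}}=Q_e^{-1}$. For a loop sequence $s$ contained in $\Lambda$ with minimal representation $(l_1,\ldots,l_n)$ put $\phi_{\Lambda,N,\beta}(s)=N^{-n}\int W_{l_1}\cdots W_{l_n}\,d\mu_{\Lambda,N,\beta}$. **Theorem.** (1) For every real $L\ge1$ there is $\beta_0(L,d)>0$ such that, for every real $\beta$ with $|\beta|\le\beta_0(L,d)$ and for every first-edge rule, there is a unique function $\phi_\beta:\mathcal S\to\mathbb R$ such that (a) $\phi_\beta(\emptyset)=1$, (b) $|\phi_\beta(s)|\le L^{|s|}$ for all $s\in\mathcal S$, and (c) $\phi_\beta$ satisfies the limiting master loop equation at $\beta$. (2) There is $\beta_0(d)>0$ such that, for every real $\beta$ with $|\beta|\le\beta_0(d)$, there is a function $\phi_\beta:\mathcal S\to\mathbb R$ that satisfies (a), (b) with $L=1$, and (c), for every first-edge rule, and such that for every sequence of finite sets $\Lambda_1\subseteq\Lambda_2\subseteq\cdots$ with union $\mathbb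 Z^d$ and every $s\in\mathcal S$, $\phi_{\Lambda_N,N,\beta}(s)\to\phi_\beta(s)$ as $N\to\infty$. -/

import Mathlib

open Filter Topology MeasureTheory

namespace LatticeGauge

/-! ### Edges, closed paths, loops -/

/-- Directed nearest neighbour edges of `ℤ^d`, from `src` to `tgt`. -/
@[ext] structure Edge (d : ℕ) where
  src : Fin d → ℤ
  tgt : Fin d → ℤ
  adj : ∑ i, |tgt i - src i| = 1

noncomputable instance (d : ℕ) : DecidableEq (Edge d) := Classical.decEq _

variable {d : ℕ}

/-- The reversed edge. -/
def Edge.inv (e : Edge d) : Edge d where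
  src := e.tgt
  tgt := e.src
  adj := by simpa only [abs_sub_comm] using e.adj

@[simp] theorem Edge.inv_src (e : Edge d) : e.inv.src = e.tgt := rfl
@[simp] theorem Edge.inv_tgt (e : Edge d) : e.inv.tgt = e.src := rfl
@[simp] theorem Edge.inv_inv (e : Edge d) : e.inv.inv = e := rfl

/-- An edge is positively oriented if its end is larger than its beginning in the lexicographic
order of `ℤ^d`. -/
def Edge.IsPos (e : Edge d) : Prop := toLex e.src < toLex e.tgt

/-- The list of edges `ρ` is a closed path: each edge ends where the next one begins, cyclically.
The null path is closed. -/
def IsClosedPath (ρ : List (Edge d)) : Prop :=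
  (ρ : Cycle (Edge d)).Chain (fun e f => e.tgt = f.src)

/-- The closed path `ρ` has no backtracks, neither interior nor terminal. -/
def IsNonbacktracking (ρ : List (Edge d)) : Prop :=
  (ρ : Cycle (Edge d)).Chain (fun e f => f ≠ e.inv)

/-- A loop is a nonbacktracking cycle: a cyclic equivalence class of closed paths that have no
backtracks. -/
def Loop (d : ℕ) : Type :=
  {c : Cycle (Edge d) //
    c.Chain (fun e f => e.tgt = f.src) ∧ c.Chain (fun e f => f ≠ e.inv)}

/-- The null loop. -/
def Loop.null : Loop d := ⟨Cycle.nil, Cycle.Chain.nil _, Cycle.Chain.nil _⟩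

/-- The length of a loop. -/
def Loop.length (l : Loop d) : ℕ := l.1.length

/-- The inverse path. -/
def invPath (ρ : List (Edge d)) : List (Edge d) := (ρ.map Edge.inv).reverse

/-- `Erase ρ ρ'`: the path `ρ'` is obtained from `ρ` by erasing one backtrack, either an interior
one or the terminal one. -/
inductive Erase : List (Edge d) → List (Edge d) → Prop
  | interior (a b : List (Edge d)) (e : Edge d) : Erase (a ++ e :: e.inv :: b) (a ++ b)
  | terminal (b : List (Edge d)) (e : Edge d) : Erase (e :: (b ++ [e.inv])) b

/-- `l` is a nonbacktracking core of the closed path `ρ`: it is the class of a path that is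
obtained from `ρ` by successive backtrack erasures. -/
def IsCore (ρ : List (Edge d)) (l : Loop d) : Prop :=
  ∃ ρ' : List (Edge d), Relation.ReflTransGen Erase ρ ρ' ∧ l.1 = (ρ' : Cycle (Edge d))

theorem Erase.length_lt {ρ ρ' : List (Edge d)} (h : Erase ρ ρ') : ρ'.length < ρ.length := by
  cases h <;> simp only [List.length_append, List.length_cons, List.length_nil] <;> omega

theorem isClosedPath_append {a b : List (Edge d)} :
    IsClosedPath (a ++ b) ↔ IsClosedPath (b ++ a) := by
  have h : ((a ++ b : List (Edge d)) : Cycle (Edge d)) = ((b ++ a : List (Edge d)) : Cycle _) :=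
    Cycle.coe_eq_coe.mpr List.isRotated_append
  unfold IsClosedPath
  rw [h]

theorem isClosedPath_erase_head {e : Edge d} {b : List (Edge d)}
    (h : IsClosedPath (e :: e.inv :: b)) : IsClosedPath b := by
  unfold IsClosedPath at *
  rw [Cycle.chain_coe_cons] at h
  cases b with
  | nil => exact Cycle.Chain.nil _
  | cons f t =>
    rw [Cycle.chain_coe_cons]
    simp only [List.cons_append, List.isChain_cons_cons, Edge.inv_src, Edge.inv_tgt] at h ⊢
    obtain ⟨-, h2, h3⟩ := h
    rw [← List.cons_append] at h3 ⊢
    rw [List.isChain_append] at h3 ⊢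
    refine ⟨h3.1, List.isChain_singleton _, ?_⟩
    intro x hx y hy
    have := h3.2.2 x hx e (by simp)
    simp only [List.head?_cons, Option.mem_def, Option.some.injEq] at hy
    rw [this, h2, hy]

theorem Erase.isClosedPath {ρ ρ' : List (Edge d)} (h : Erase ρ ρ') (hρ : IsClosedPath ρ) :
    IsClosedPath ρ' := by
  cases h with
  | interior a b e =>
    rw [isClosedPath_append] at hρ ⊢
    exact isClosedPath_erase_head (by simpa using hρ)
  | terminal b e =>
    rw [← List.cons_append, isClosedPath_append] at hρ
    exact isClosedPath_erase_head (e := e.inv) (by simpa using hρ)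

theorem exists_not_of_not_isChain {α : Type*} {r : α → α → Prop} :
    ∀ {l : List α}, ¬ l.IsChain r → ∃ u x y v, l = u ++ x :: y :: v ∧ ¬ r x y
  | [], h => (h List.isChain_nil).elim
  | [_], h => (h (List.isChain_singleton _)).elim
  | x :: y :: v, h => by
    rw [List.isChain_cons_cons] at h
    by_cases hr : r x y
    · obtain ⟨u, x', y', v', h1, h2⟩ := exists_not_of_not_isChain (fun h' => h ⟨hr, h'⟩)
      exact ⟨x :: u, x', y', v', by rw [h1]; rfl, h2⟩
    · exact ⟨[], x, y, v, rfl, hr⟩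

theorem exists_erase {ρ : List (Edge d)} (h : ¬ IsNonbacktracking ρ) : ∃ ρ', Erase ρ ρ' := by
  unfold IsNonbacktracking at h
  cases ρ with
  | nil => exact (h (Cycle.Chain.nil _)).elim
  | cons a t =>
    rw [Cycle.chain_coe_cons] at h
    obtain ⟨u, x, y, v, h1, h2⟩ := exists_not_of_not_isChain h
    rw [not_not] at h2
    subst h2
    rcases List.eq_nil_or_concat v with rfl | ⟨v', z, rfl⟩
    · have h3 : (a :: t) ++ [a] = (u ++ [x]) ++ [x.inv] := by simpa using h1
      obtain ⟨h4, h5⟩ := List.append_inj' h3 rfl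
      cases u with
      | nil =>
        simp only [List.nil_append, List.cons.injEq] at h4 h5
        have h6 : x = x.inv := h4.1.symm.trans h5.1
        have h7 := x.adj
        have h8 : x.src = x.tgt := congrArg Edge.src h6
        simp [h8] at h7
      | cons w u' =>
        simp only [List.cons_append, List.cons.injEq] at h4 h5
        refine ⟨u', ?_⟩
        have := Erase.terminal u' a
        rw [h5.1] at this
        rw [h4.2, h5.1]
        simpa using this
    · have h3 : (a :: t) ++ [a] = (u ++ x :: x.inv :: v') ++ [z] := by simpa using h1
      obtain ⟨h4, -⟩ := List.append_inj' h3 rfl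
      exact ⟨_, h4 ▸ Erase.interior u v' x⟩

/-- Every closed path has a nonbacktracking core. -/
theorem exists_core : ∀ (n : ℕ) (ρ : List (Edge d)), ρ.length = n → IsClosedPath ρ →
    ∃ l : Loop d, IsCore ρ l := by
  intro n
  induction n using Nat.strong_induction_on with
  | _ n ih =>
    intro ρ hn hρ
    by_cases h : IsNonbacktracking ρ
    · exact ⟨⟨ρ, hρ, h⟩, ρ, Relation.ReflTransGen.refl, rfl⟩
    · obtain ⟨ρ', h'⟩ := exists_erase h
      obtain ⟨l, ρ'', h1, h2⟩ := ih _ (hn ▸ h'.length_lt) ρ' rfl (h'.isClosedPath hρ)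
      exact ⟨l, ρ'', Relation.ReflTransGen.head h' h1, h2⟩

open Classical in
/-- The nonbacktracking core `[ρ]` of a closed path `ρ`. It is unique; it is only ever taken of
closed paths (the value elsewhere is a dummy). -/
noncomputable def core (ρ : List (Edge d)) : Loop d :=
  if h : IsClosedPath ρ then (exists_core ρ.length ρ rfl h).choose else Loop.null

/-! ### Loop sequences -/

open Classical in
/-- The list of loops with its null loops deleted. -/
noncomputable def dropNull (s : List (Loop d)) : List (Loop d) :=
  s.filter (fun l => l ≠ Loop.null)

/-- Two finite sequences of loops are equivalent if they differ by inserting and deleting null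
loops, that is, if they agree after all null loops are deleted. -/
noncomputable def loopSeqSetoid (d : ℕ) : Setoid (List (Loop d)) := Setoid.ker dropNull

/-- Loop sequences: equivalence classes of finite sequences of loops. -/
def LoopSeq (d : ℕ) : Type := Quotient (loopSeqSetoid d)

/-- The loop sequence represented by a finite sequence of loops, null loops allowed. -/
noncomputable def LoopSeq.mk (s : List (Loop d)) : LoopSeq d := Quotient.mk (loopSeqSetoid d) s

/-- The null loop sequence. -/
noncomputable def LoopSeq.null : LoopSeq d := LoopSeq.mk [Loop.null]

/-- The minimal representation of a loop sequence: the representative without null loops. -/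
noncomputable def LoopSeq.minRep (s : LoopSeq d) : List (Loop d) :=
  Quotient.lift dropNull (fun _ _ h => Setoid.ker_def.mp h) s

/-- The length `|s|` of a loop sequence. -/
noncomputable def LoopSeq.length (s : LoopSeq d) : ℕ := (s.minRep.map Loop.length).sum

/-! ### Plaquettes -/

/-- Positively oriented plaquettes: nonbacktracking closed paths `e₁e₂e₃e₄` such that `u(e₁)` is
the lexicographically smallest vertex and `v(e₁)` is the second smallest one. (Every vertex of a
closed path is the beginning of one of its edges.) -/
def IsPosPlaquette (p : List (Edge d)) : Prop :=
  IsClosedPath p ∧ IsNonbacktracking p ∧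
    ∃ e₁ e₂ e₃ e₄ : Edge d, p = [e₁, e₂, e₃, e₄] ∧
      (∀ f ∈ p, toLex e₁.src ≤ toLex f.src) ∧
      (∀ f ∈ p, f.src ≠ e₁.src → toLex e₁.tgt ≤ toLex f.src)

theorem finite_edges (Λ : Finset (Fin d → ℤ)) :
    {e : Edge d | e.src ∈ Λ ∧ e.tgt ∈ Λ}.Finite := by
  refine Set.Finite.of_finite_image (f := fun e : Edge d => (e.src, e.tgt))
    (((Λ ×ˢ Λ : Finset _).finite_toSet).subset ?_) ?_
  · rintro _ ⟨e, he, rfl⟩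
    simpa using he
  · intro e _ f _ h
    simp only [Prod.mk.injEq] at h
    exact Edge.ext h.1 h.2

theorem finite_paths (Λ : Finset (Fin d → ℤ)) (n : ℕ) :
    {p : List (Edge d) | p.length = n ∧ ∀ f ∈ p, f.src ∈ Λ ∧ f.tgt ∈ Λ}.Finite := by
  have : Finite {e : Edge d | e.src ∈ Λ ∧ e.tgt ∈ Λ} := finite_edges Λ
  refine ((List.finite_length_eq {e : Edge d | e.src ∈ Λ ∧ e.tgt ∈ Λ} n).image
    (List.map Subtype.val)).subset ?_
  rintro p ⟨h1, h2⟩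
  refine ⟨p.attach.map (fun f => ⟨f.1, h2 f.1 f.2⟩), by
    change (List.map _ _).length = n
    simpa using h1, ?_⟩
  simp [List.map_map, Function.comp_def]

theorem Edge.abs_sub_le (e : Edge d) (i : Fin d) : |e.tgt i - e.src i| ≤ 1 := by
  rw [← e.adj]
  exact Finset.single_le_sum (f := fun i => |e.tgt i - e.src i|) (fun _ _ => abs_nonneg _)
    (Finset.mem_univ i)

theorem finite_plaquettesIn (Λ : Finset (Fin d → ℤ)) :
    {p : List (Edge d) | IsPosPlaquette p ∧ ∀ f ∈ p, f.src ∈ Λ ∧ f.tgt ∈ Λ}.Finite := by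
  refine (finite_paths Λ 4).subset ?_
  rintro p ⟨⟨-, -, e₁, e₂, e₃, e₄, rfl, -⟩, h⟩
  exact ⟨rfl, h⟩

theorem finite_plaquettesAt (e : Edge d) :
    {p : List (Edge d) | IsPosPlaquette p ∧ (e ∈ p ∨ e.inv ∈ p)}.Finite := by
  refine (finite_plaquettesIn (Finset.Icc (fun i => e.src i - 5) (fun i => e.src i + 5))).subset ?_
  rintro p ⟨hp, he⟩
  refine ⟨hp, ?_⟩
  obtain ⟨hc, -, e₁, e₂, e₃, e₄, rfl, -⟩ := hp
  have hc' : e₁.tgt = e₂.src ∧ e₂.tgt = e₃.src ∧ e₃.tgt = e₄.src ∧ e₄.tgt = e₁.src := by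
    unfold IsClosedPath at hc
    rw [Cycle.chain_coe_cons] at hc
    simpa using hc
  obtain ⟨c1, c2, c3, c4⟩ := hc'
  have key : ∀ i, ∃ z : ℤ, (z = e.src i ∨ z = e.tgt i) ∧
      (z = e₁.src i ∨ z = e₂.src i ∨ z = e₃.src i ∨ z = e₄.src i) := by
    intro i
    rcases he with he | he
    · simp only [List.mem_cons, List.not_mem_nil, or_false] at he
      exact ⟨e.src i, Or.inl rfl, by rcases he with h | h | h | h <;> simp [h]⟩
    · simp only [List.mem_cons, List.not_mem_nil, or_false] at he
      exact ⟨e.tgt i, Or.inr rfl, by rcases he with h | h | h | h <;> simp [← h]⟩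
  have bound : ∀ f ∈ [e₁, e₂, e₃, e₄], ∀ i,
      (e.src i - 5 ≤ f.src i ∧ f.src i ≤ e.src i + 5) ∧
      (e.src i - 5 ≤ f.tgt i ∧ f.tgt i ≤ e.src i + 5) := by
    intro f hf i
    obtain ⟨z, h1, h2⟩ := key i
    have b0 := abs_le.mp (e.abs_sub_le i)
    have b1 := abs_le.mp (e₁.abs_sub_le i)
    have b2 := abs_le.mp (e₂.abs_sub_le i)
    have b3 := abs_le.mp (e₃.abs_sub_le i)
    have b4 := abs_le.mp (e₄.abs_sub_le i)
    have d1 := congrFun c1 i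
    have d2 := congrFun c2 i
    have d3 := congrFun c3 i
    have d4 := congrFun c4 i
    simp only [List.mem_cons, List.not_mem_nil, or_false] at hf
    rcases hf with rfl | rfl | rfl | rfl <;> refine ⟨⟨?_, ?_⟩, ?_, ?_⟩ <;> omega
  intro f hf
  simp only [Finset.mem_Icc, Pi.le_def]
  exact ⟨⟨fun i => (bound f hf i).1.1, fun i => (bound f hf i).1.2⟩,
    ⟨fun i => (bound f hf i).2.1, fun i => (bound f hf i).2.2⟩⟩

/-- `𝒫⁺_Λ`, the positively oriented plaquettes all of whose vertices are in `Λ`. -/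
noncomputable def plaquettesIn (Λ : Finset (Fin d → ℤ)) : Finset (List (Edge d)) :=
  (finite_plaquettesIn Λ).toFinset

/-- `𝒫⁺(e)`, the positively oriented plaquettes that contain `e` or its inverse. -/
noncomputable def plaquettesAt (e : Edge d) : Finset (List (Edge d)) :=
  (finite_plaquettesAt e).toFinset

/-! ### Operations on loops

A loop is given by one of the closed paths `ρ` in its class; locations are numbered from `0`. -/

/-- The part of the path strictly before location `x`. -/
def before (ρ : List (Edge d)) (x : ℕ) : List (Edge d) := ρ.take x

/-- The part of the path strictly after location `x`. -/
def after (ρ : List (Edge d)) (x : ℕ) : List (Edge d) := ρ.drop (x + 1)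

/-- The part of the path strictly between the locations `x < y`. -/
def between (ρ : List (Edge d)) (x y : ℕ) : List (Edge d) := (ρ.take y).drop (x + 1)

/-- The pair of loops `[aec], [be]` for a path `ρ = aebec` with the two `e`'s at the locations `x < y`;
splitting at `y, x` gives the same two loops in reverse order. -/
noncomputable def posSplit (ρ : List (Edge d)) (e : Edge d) (x y : ℕ) : Loop d × Loop d :=
  if x < y then (core (before ρ x ++ e :: after ρ y), core (between ρ x y ++ [e]))
  else (core (between ρ y x ++ [e]), core (before ρ y ++ e :: after ρ x))

/-- The pair of loops `[ac], [b]` for a path `ρ = aebe⁻¹c` with `e`, `e⁻¹` at the locations `x < y`;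
splitting at `y, x` gives the same two loops in reverse order. -/
noncomputable def negSplit (ρ : List (Edge d)) (x y : ℕ) : Loop d × Loop d :=
  if x < y then (core (before ρ x ++ after ρ y), core (between ρ x y))
  else (core (between ρ y x), core (before ρ y ++ after ρ x))

/-- The positive merger of `ρ = aeb`, with `e` at location `x`, and `ρ'` at location `y`: it is
`[aedceb]` if `ρ' = ced`, and `[aec⁻¹d⁻¹eb]` if `ρ' = ce⁻¹d`. -/
noncomputable def posMerge (ρ : List (Edge d)) (e : Edge d) (x : ℕ) (ρ' : List (Edge d)) (y : ℕ) :
    Loop d :=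
  if ρ'[y]? = some e then
    core (before ρ x ++ [e] ++ after ρ' y ++ before ρ' y ++ [e] ++ after ρ x)
  else
    core (before ρ x ++ [e] ++ invPath (before ρ' y) ++ invPath (after ρ' y) ++ [e] ++ after ρ x)

/-- The negative merger of `ρ = aeb`, with `e` at location `x`, and `ρ'` at location `y`: it is
`[ac⁻¹d⁻¹b]` if `ρ' = ced`, and `[adcb]` if `ρ' = ce⁻¹d`. -/
noncomputable def negMerge (ρ : List (Edge d)) (e : Edge d) (x : ℕ) (ρ' : List (Edge d)) (y : ℕ) :
    Loop d :=
  if ρ'[y]? = some e then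
    core (before ρ x ++ invPath (before ρ' y) ++ invPath (after ρ' y) ++ after ρ x)
  else
    core (before ρ x ++ after ρ' y ++ before ρ' y ++ after ρ x)

/-- The location in a plaquette `p` at which `e` or its inverse occurs. -/
noncomputable def locIn (p : List (Edge d)) (e : Edge d) : ℕ :=
  p.findIdx (fun f => decide (f = e ∨ f = e.inv))

/-- The positive deformation `ρ ⊕ₓ p`, where `e` is the edge of `ρ` at location `x`. -/
noncomputable def posDeform (ρ : List (Edge d)) (e : Edge d) (x : ℕ) (p : List (Edge d)) :
    Loop d :=
  posMerge ρ e x p (locIn p e)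

/-- The negative deformation `ρ ⊖ₓ p`, where `e` is the edge of `ρ` at location `x`. -/
noncomputable def negDeform (ρ : List (Edge d)) (e : Edge d) (x : ℕ) (p : List (Edge d)) :
    Loop d :=
  negMerge ρ e x p (locIn p e)

/-! ### The master loop equation in the 't Hooft limit -/

/-- A rule that fixes the first edge of every loop, and thereby all its locations: it picks one of
the closed paths in the class. -/
structure FirstEdgeRule (d : ℕ) where
  path : Loop d → List (Edge d)
  path_mem : ∀ l, (path l : Cycle (Edge d)) = l.1

/-- The set of locations in `ρ` where the edge `e` occurs. -/
noncomputable def locs (ρ : List (Edge d)) (e : Edge d) : Finset ℕ :=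
  (Finset.range ρ.length).filter (fun x => ρ[x]? = some e)

/-- The splitting term for the loop sequence `(l₁, l₂, …, lₙ)`, where `ρ` is the closed path
representing `l₁` and `ls = (l₂, …, lₙ)`. -/
noncomputable def splittingTerm (φ : LoopSeq d → ℝ) (ρ : List (Edge d)) (e : Edge d)
    (ls : List (Loop d)) : ℝ :=
  let A := locs ρ e
  let B := locs ρ e.inv
  (∑ x ∈ A, ∑ y ∈ B, φ (.mk ((negSplit ρ x y).1 :: (negSplit ρ x y).2 :: ls)))
    + (∑ x ∈ B, ∑ y ∈ A, φ (.mk ((negSplit ρ x y).1 :: (negSplit ρ x y).2 :: ls)))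
    - (∑ x ∈ A, ∑ y ∈ A.erase x, φ (.mk ((posSplit ρ e x y).1 :: (posSplit ρ e x y).2 :: ls)))
    - (∑ x ∈ B, ∑ y ∈ B.erase x,
        φ (.mk ((posSplit ρ e.inv x y).1 :: (posSplit ρ e.inv x y).2 :: ls)))

/-- The deformation term. At a location in `A` the deformed edge is `e`, at a location in `B` it
is `e⁻¹`; the sums over `A` and over `B` together make the sum over `C = A ∪ B`. -/
noncomputable def deformationTerm (β : ℝ) (φ : LoopSeq d → ℝ) (ρ : List (Edge d)) (e : Edge d)
    (ls : List (Loop d)) : ℝ :=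
  let A := locs ρ e
  let B := locs ρ e.inv
  β * (∑ p ∈ plaquettesAt e,
      ((∑ x ∈ A, φ (.mk (negDeform ρ e x p :: ls)))
        + ∑ x ∈ B, φ (.mk (negDeform ρ e.inv x p :: ls))))
    - β * (∑ p ∈ plaquettesAt e,
      ((∑ x ∈ A, φ (.mk (posDeform ρ e x p :: ls)))
        + ∑ x ∈ B, φ (.mk (posDeform ρ e.inv x p :: ls))))

/-- The master loop equation in the 't Hooft limit: for every non-null loop sequence with minimal
representation `(l₁, …, lₙ)`, where `e` is the first edge of `l₁`. -/
def MasterLoopEq (R : FirstEdgeRule d) (β : ℝ) (φ : LoopSeq d → ℝ) : Prop :=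
  ∀ (s : LoopSeq d) (l₁ : Loop d) (ls : List (Loop d)), s.minRep = l₁ :: ls →
    ∀ (e : Edge d) (τ : List (Edge d)), R.path l₁ = e :: τ →
      ((locs (R.path l₁) e ∪ locs (R.path l₁) e.inv).card : ℝ) * φ s =
        splittingTerm φ (R.path l₁) e ls + deformationTerm β φ (R.path l₁) e ls

/-- `φ(∅) = 1`, `|φ(s)| ≤ L^|s|` for all `s`, and `φ` satisfies the master loop equation. -/
structure IsMasterSolution (R : FirstEdgeRule d) (L β : ℝ) (φ : LoopSeq d → ℝ) : Prop where
  null : φ LoopSeq.null = 1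
  bound : ∀ s, |φ s| ≤ L ^ s.length
  master : MasterLoopEq R β φ

/-! ### `SO(N)` lattice gauge theory on a finite set `Λ` -/

/-- The group `SO(N)`. -/
abbrev SO (N : ℕ) : Type := Matrix.specialOrthogonalGroup (Fin N) ℝ

instance (N : ℕ) : MeasurableSpace (SO N) := borel _

instance (N : ℕ) : BorelSpace (SO N) := ⟨rfl⟩

theorem SO.coe_inv {N : ℕ} (A : SO N) :
    ((A⁻¹ : SO N) : Matrix (Fin N) (Fin N) ℝ) = star (A : Matrix (Fin N) (Fin N) ℝ) := rfl

instance (N : ℕ) : IsTopologicalGroup (SO N) where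
  continuous_inv := by
    refine Continuous.subtype_mk ?_ _
    exact Continuous.matrix_conjTranspose continuous_subtype_val

instance (N : ℕ) : CompactSpace (SO N) := by
  refine isCompact_iff_compactSpace.mp ?_
  have hbox : IsCompact (Set.pi Set.univ
      (fun _ : Fin N => Set.pi Set.univ (fun _ : Fin N => Set.Icc (-1 : ℝ) 1))) :=
    isCompact_univ_pi fun _ => isCompact_univ_pi fun _ => isCompact_Icc
  refine hbox.of_isClosed_subset ?_ ?_
  · have h : ((Matrix.specialOrthogonalGroup (Fin N) ℝ : Submonoid _) :
        Set (Matrix (Fin N) (Fin N) ℝ)) = {A | A * A.transpose = 1} ∩ {A | A.det = 1} := by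
      ext A
      simp only [SetLike.mem_coe, Matrix.mem_specialOrthogonalGroup_iff,
        Matrix.mem_orthogonalGroup_iff, Set.mem_inter_iff, Set.mem_ofPred_eq]
    rw [h]
    exact (isClosed_eq (by fun_prop) continuous_const).inter
      (isClosed_eq (by fun_prop) continuous_const)
  · intro A hA i _ j _
    have h := entry_norm_bound_of_unitary (𝕜 := ℝ)
      (Matrix.mem_specialOrthogonalGroup_iff.mp hA).1 i j
    exact abs_le.mp h

/-- The Haar probability measure on `SO(N)`. -/
noncomputable def haarSO (N : ℕ) : Measure (SO N) := Measure.haarMeasure ⊤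

/-- `E⁺_Λ`, the positively oriented edges with both ends in `Λ`. -/
abbrev PosEdgeIn (Λ : Finset (Fin d → ℤ)) : Type :=
  {e : Edge d // e.IsPos ∧ e.src ∈ Λ ∧ e.tgt ∈ Λ}

noncomputable instance (Λ : Finset (Fin d → ℤ)) : Fintype (PosEdgeIn Λ) :=
  ((finite_edges Λ).subset
    (show {e : Edge d | e.IsPos ∧ e.src ∈ Λ ∧ e.tgt ∈ Λ} ⊆ _ from fun _ h => h.2)).fintype

/-- Configurations `Q = (Q_e)` of the gauge field. -/
abbrev Config (Λ : Finset (Fin d → ℤ)) (N : ℕ) : Type := PosEdgeIn Λ → SO N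

open Classical in
/-- `Q_e` for any directed edge `e` in `Λ`, with `Q_e = (Q_{e⁻¹})⁻¹` if `e` is negatively oriented
(the value for edges outside `Λ` is a dummy). -/
noncomputable def edgeVar {Λ : Finset (Fin d → ℤ)} {N : ℕ} (Q : Config Λ N) (e : Edge d) : SO N :=
  if h : e.IsPos ∧ e.src ∈ Λ ∧ e.tgt ∈ Λ then Q ⟨e, h⟩
  else if h : e.inv.IsPos ∧ e.inv.src ∈ Λ ∧ e.inv.tgt ∈ Λ then (Q ⟨e.inv, h⟩)⁻¹
  else 1

/-- `Tr(Q_{e₁} ⋯ Q_{eₙ})` for a path `e₁⋯eₙ`; this is `N` for the null path. -/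
noncomputable def pathTrace {Λ : Finset (Fin d → ℤ)} {N : ℕ} (Q : Config Λ N)
    (ρ : List (Edge d)) : ℝ :=
  Matrix.trace ((ρ.map (edgeVar Q)).prod : SO N).1

theorem pathTrace_rotated {Λ : Finset (Fin d → ℤ)} {N : ℕ} (Q : Config Λ N)
    {ρ ρ' : List (Edge d)} (h : ρ.IsRotated ρ') : pathTrace Q ρ = pathTrace Q ρ' := by
  obtain ⟨n, rfl⟩ := h
  rw [List.rotate_eq_drop_append_take_mod]
  conv_lhs => rw [← List.take_append_drop (n % ρ.length) ρ]
  unfold pathTrace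
  rw [List.map_append, List.map_append, List.prod_append, List.prod_append]
  exact Matrix.trace_mul_comm _ _

/-- The Wilson loop variable `W_l`. -/
noncomputable def wilson {Λ : Finset (Fin d → ℤ)} {N : ℕ} (Q : Config Λ N) (l : Loop d) : ℝ :=
  Quotient.lift (pathTrace Q)
    (fun _ _ h => pathTrace_rotated Q (Cycle.coe_eq_coe.mp (Quotient.sound h))) l.1

/-- The lattice gauge measure `μ_{Λ,N,β}`: the product of Haar measures, with density
`Z⁻¹ exp(Nβ ∑_p Tr Q_p)`, the sum being over `𝒫⁺_Λ`. -/
noncomputable def gaugeMeasure (Λ : Finset (Fin d → ℤ)) (N : ℕ) (β : ℝ) : Measure (Config Λ N) :=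
  (Measure.pi fun _ : PosEdgeIn Λ => haarSO N).tilted
    fun Q => N * β * ∑ p ∈ plaquettesIn Λ, pathTrace Q p

/-- `φ_{Λ,N,β}(s) = ⟨W_{l₁} ⋯ W_{lₙ}⟩ / Nⁿ`, where `(l₁, …, lₙ)` is the minimal representation of
`s`. -/
noncomputable def wilsonPhi (Λ : Finset (Fin d → ℤ)) (N : ℕ) (β : ℝ) (s : LoopSeq d) : ℝ :=
  (∫ Q, (s.minRep.map (wilson Q)).prod ∂(gaugeMeasure Λ N β)) / (N : ℝ) ^ s.minRep.length

end LatticeGauge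

open LatticeGauge

/-!
Uniqueness: the master loop equation writes `m φ(s)` as a sum of `m` terms, one for each location
of the first edge `e` of `l₁` or of `e⁻¹`. Give a loop of length `n ≥ 1` the weight `Kⁿ / (64 n²)`
and a loop sequence the product of the weights of its loops. The weights of all splittings of a loop
at a fixed location add up to at most `1/4` of the weight of the loop, because
`∑ₖ 1 / (k² (n - k)²)` is of order `1 / n²`, and a deformation multiplies the weight by at most
`K⁴`. So for small `β` a bound by `M` times the weight on the difference of two solutions improves
to one by `M / 2` times the weight, and the difference vanishes.

Existence: for an infinitesimal rotation `X`, the Haar measure is invariant under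
`Q_e ↦ exp(tX) Q_e`, so integrating by parts the function `Tr(X Q_{l₁}) W_{l₂} ⋯ W_{lₙ}` and
summing over an orthogonal basis of the Lie algebra of `SO(N)` gives an equation for `φ_{Λ,N,β}` at
each single location. The contraction identities `∑ Tr(XPXR) ∼ Tr(PᵀR) - Tr P Tr R` and
`∑ Tr(XP) Tr(XR) ∼ Tr(PRᵀ) - Tr(PR)` turn it into the equation of the limit, up to an error of
order `1 / N`. As `|φ_{Λ,N,β}| ≤ 1`, limits along ultrafilters exist and solve the equation with
`L = 1` for every `β`; for small `β` they all coincide by uniqueness, which is convergence.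
-/

namespace LatticeGauge

variable {d : ℕ}

/-! ### Walks, closed paths and cores -/

/-- A walk from `u` to `v`, given by its consecutive edges. Unlike a closed path it remembers its
base point, so it can be cut and concatenated. -/
def IsWalk : (Fin d → ℤ) → List (Edge d) → (Fin d → ℤ) → Prop
  | u, [], v => u = v
  | u, f :: t, v => f.src = u ∧ IsWalk f.tgt t v

@[simp] theorem isWalk_nil {u v : Fin d → ℤ} : IsWalk u [] v ↔ u = v := Iff.rfl

@[simp] theorem isWalk_cons {u v : Fin d → ℤ} {f : Edge d} {t : List (Edge d)} :
    IsWalk u (f :: t) v ↔ f.src = u ∧ IsWalk f.tgt t v := Iff.rfl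

theorem isWalk_append {a b : List (Edge d)} {u v : Fin d → ℤ} :
    IsWalk u (a ++ b) v ↔ ∃ w, IsWalk u a w ∧ IsWalk w b v := by
  induction a generalizing u with
  | nil => simp
  | cons f t ih => simp [ih, and_assoc]

theorem invPath_cons (f : Edge d) (t : List (Edge d)) :
    invPath (f :: t) = invPath t ++ [f.inv] := by
  simp [invPath]

theorem length_invPath (ρ : List (Edge d)) : (invPath ρ).length = ρ.length := by
  simp [invPath]

theorem invPath_append (a b : List (Edge d)) : invPath (a ++ b) = invPath b ++ invPath a := by
  simp [invPath]

theorem invPath_invPath (ρ : List (Edge d)) : invPath (invPath ρ) = ρ := by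
  simp [invPath, Function.comp_def]

theorem IsWalk.invPath {ρ : List (Edge d)} {u v : Fin d → ℤ} (h : IsWalk u ρ v) :
    IsWalk v (invPath ρ) u := by
  induction ρ generalizing u with
  | nil => exact h.symm
  | cons f t ih =>
    rw [invPath_cons, isWalk_append]
    exact ⟨f.tgt, ih h.2, rfl, h.1⟩

theorem isChain_cons_append_singleton_iff {t : List (Edge d)} {a b : Edge d} :
    (a :: (t ++ [b])).IsChain (fun e f => e.tgt = f.src) ↔ IsWalk a.tgt t b.src := by
  induction t generalizing a with
  | nil => simp
  | cons f t ih => simp [List.isChain_cons_cons, ← ih, eq_comm]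

theorem isClosedPath_iff {ρ : List (Edge d)} : IsClosedPath ρ ↔ ∃ u, IsWalk u ρ u := by
  unfold IsClosedPath
  cases ρ with
  | nil => exact iff_of_true (Cycle.Chain.nil _) ⟨0, rfl⟩
  | cons a t => rw [Cycle.chain_coe_cons, isChain_cons_append_singleton_iff]; simp

theorem Loop.exists_coe_eq (l : Loop d) : ∃ ρ : List (Edge d), (ρ : Cycle (Edge d)) = l.1 :=
  Quotient.exists_rep l.1

theorem Loop.isClosedPath {l : Loop d} {ρ : List (Edge d)} (h : (ρ : Cycle (Edge d)) = l.1) :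
    IsClosedPath ρ := by
  unfold IsClosedPath; rw [h]; exact l.2.1

theorem Loop.length_eq {l : Loop d} {ρ : List (Edge d)} (h : (ρ : Cycle (Edge d)) = l.1) :
    l.length = ρ.length := by
  unfold Loop.length; rw [← h]; rfl

theorem Loop.length_pos {l : Loop d} (h : l ≠ Loop.null) : 0 < l.length := by
  obtain ⟨ρ, hρ⟩ := l.exists_coe_eq
  rw [Loop.length_eq hρ, List.length_pos_iff]
  rintro rfl
  exact h (Subtype.ext hρ.symm)

theorem isCore_core {ρ : List (Edge d)} (h : IsClosedPath ρ) : IsCore ρ (core ρ) := by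
  unfold core
  rw [dif_pos h]
  exact (exists_core ρ.length ρ rfl h).choose_spec

theorem IsCore.length_le {ρ : List (Edge d)} {l : Loop d} (h : IsCore ρ l) :
    l.length ≤ ρ.length := by
  obtain ⟨ρ', hρ', hl⟩ := h
  rw [Loop.length_eq hl.symm]
  clear hl
  induction hρ' with
  | refl => exact le_rfl
  | tail _ h ih => exact h.length_lt.le.trans ih

theorem length_core_le (ρ : List (Edge d)) : (core ρ).length ≤ ρ.length := by
  by_cases h : IsClosedPath ρ
  · exact (isCore_core h).length_le
  · unfold core
    rw [dif_neg h]
    exact Nat.zero_le _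

theorem Edge.src_ne_tgt (e : Edge d) : e.src ≠ e.tgt := by
  intro h
  simpa [h] using e.adj

theorem Edge.ne_inv (e : Edge d) : e ≠ e.inv := fun h => e.src_ne_tgt (congrArg Edge.src h)

theorem Edge.inv_injective : Function.Injective (Edge.inv : Edge d → Edge d) :=
  Function.LeftInverse.injective Edge.inv_inv

theorem Edge.isPos_inv_iff (e : Edge d) : e.inv.IsPos ↔ ¬ e.IsPos := by
  have h : toLex e.src ≠ toLex e.tgt := fun h => e.src_ne_tgt (toLex_inj.mp h)
  exact ⟨fun h₁ h₂ => lt_asymm (α := Lex (Fin d → ℤ)) h₁ h₂,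
    fun h' => (lt_trichotomy (α := Lex (Fin d → ℤ)) _ _).resolve_left h' |>.resolve_left h⟩

/-! ### Locations -/

theorem mem_locs {ρ : List (Edge d)} {e : Edge d} {x : ℕ} : x ∈ locs ρ e ↔ ρ[x]? = some e := by
  simp only [locs, Finset.mem_filter, Finset.mem_range, and_iff_right_iff_imp]
  exact fun h => (List.getElem?_eq_some_iff.mp h).1

theorem card_locs_le (ρ : List (Edge d)) (e : Edge d) : (locs ρ e).card ≤ ρ.length :=
  (Finset.card_filter_le _ _).trans_eq (Finset.card_range _)

theorem locs_eq_empty {ρ : List (Edge d)} {e : Edge d} (h : e ∉ ρ) : locs ρ e = ∅ :=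
  Finset.eq_empty_of_forall_notMem fun _ hx => h (List.mem_of_getElem? (mem_locs.mp hx))

theorem disjoint_locs_inv (ρ : List (Edge d)) (e : Edge d) :
    Disjoint (locs ρ e) (locs ρ e.inv) := by
  rw [Finset.disjoint_left]
  intro x hx hx'
  rw [mem_locs] at hx hx'
  exact e.ne_inv (Option.some.inj (hx.symm.trans hx'))

theorem eq_before_append {ρ : List (Edge d)} {e : Edge d} {x : ℕ} (h : ρ[x]? = some e) :
    ρ = before ρ x ++ e :: after ρ x := by
  obtain ⟨hx, rfl⟩ := List.getElem?_eq_some_iff.mp h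
  rw [before, after, List.cons_getElem_drop_succ, List.take_append_drop]

theorem IsWalk.before {ρ : List (Edge d)} {u v : Fin d → ℤ} {e : Edge d} {x : ℕ}
    (h : IsWalk u ρ v) (hx : ρ[x]? = some e) : IsWalk u (before ρ x) e.src := by
  rw [eq_before_append hx, isWalk_append] at h
  obtain ⟨_, hbefore, rfl, -⟩ := h
  exact hbefore

theorem IsWalk.after {ρ : List (Edge d)} {u v : Fin d → ℤ} {e : Edge d} {x : ℕ}
    (h : IsWalk u ρ v) (hx : ρ[x]? = some e) : IsWalk e.tgt (after ρ x) v := by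
  rw [eq_before_append hx, isWalk_append] at h
  obtain ⟨_, -, -, hafter⟩ := h
  exact hafter

theorem length_before {ρ : List (Edge d)} {x : ℕ} (h : x < ρ.length) :
    (before ρ x).length = x := by
  simp [before, h.le]

theorem length_after (ρ : List (Edge d)) (x : ℕ) :
    (after ρ x).length = ρ.length - (x + 1) := by
  simp [after]

theorem length_between {ρ : List (Edge d)} {x y : ℕ} (hy : y < ρ.length) :
    (between ρ x y).length = y - (x + 1) := by
  simp [between, hy.le]

section SumLocs

variable {M : Type*} [AddCommMonoid M]

theorem sum_locs_append (a b : List (Edge d)) (f : Edge d) (G : ℕ → M) :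
    ∑ y ∈ locs (a ++ b) f, G y = ∑ y ∈ locs a f, G y + ∑ y ∈ locs b f, G (a.length + y) := by
  simp only [locs, Finset.sum_filter, List.length_append]
  rw [Finset.sum_range_add]
  congr 1
  · refine Finset.sum_congr rfl fun y hy => ?_
    rw [List.getElem?_append_left (Finset.mem_range.mp hy)]
  · refine Finset.sum_congr rfl fun y _ => ?_
    rw [List.getElem?_append_right (Nat.le_add_right _ _), Nat.add_sub_cancel_left]

theorem sum_locs_singleton (e f : Edge d) (G : ℕ → M) :
    ∑ y ∈ locs [e] f, G y = if e = f then G 0 else 0 := by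
  simp [locs, Finset.sum_filter]

theorem sum_locs_cons (e : Edge d) (c : List (Edge d)) (f : Edge d) (G : ℕ → M) :
    ∑ y ∈ locs (e :: c) f, G y = (if e = f then G 0 else 0) + ∑ y ∈ locs c f, G (1 + y) := by
  rw [← List.singleton_append, sum_locs_append, sum_locs_singleton, List.length_singleton]

theorem sum_locs_erase {ρ : List (Edge d)} {e : Edge d} {x : ℕ} (hx : ρ[x]? = some e) (f : Edge d)
    (G : ℕ → M) :
    ∑ y ∈ (locs ρ f).erase x, G y =
      ∑ y ∈ locs (before ρ x) f, G y + ∑ y ∈ locs (after ρ x) f, G (x + 1 + y) := by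
  have hlen : (before ρ x).length = x := length_before (List.getElem?_eq_some_iff.mp hx).1
  set G₀ : ℕ → M := Function.update G x 0
  have hG₀x : G₀ x = 0 := Function.update_self _ _ _
  have hG₀ : ∀ y ≠ x, G₀ y = G y := fun y hy => Function.update_of_ne hy _ _
  have hbefore : ∀ y ∈ locs (before ρ x) f, G₀ y = G y := fun y hy => hG₀ y <| by
    have := (List.getElem?_eq_some_iff.mp (mem_locs.mp hy)).1
    lia
  have hafter : ∀ y ∈ locs (after ρ x) f, G₀ (x + (1 + y)) = G (x + 1 + y) := fun y _ => by
    rw [hG₀ _ (by lia), add_assoc]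
  calc ∑ y ∈ (locs ρ f).erase x, G y
      = ∑ y ∈ (locs ρ f).erase x, G₀ y :=
        Finset.sum_congr rfl fun y hy => (hG₀ y (Finset.ne_of_mem_erase hy)).symm
    _ = ∑ y ∈ locs ρ f, G₀ y := Finset.sum_erase _ hG₀x
    _ = ∑ y ∈ locs (before ρ x ++ e :: after ρ x) f, G₀ y := by rw [← eq_before_append hx]
    _ = _ := by
      rw [sum_locs_append, sum_locs_cons, hlen, add_zero, hG₀x, ite_self, zero_add,
        Finset.sum_congr rfl hbefore, Finset.sum_congr rfl hafter]

end SumLocs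

/-! ### Loop sequences -/

theorem dropNull_cons_of_ne {l : Loop d} (h : l ≠ Loop.null) (ls : List (Loop d)) :
    dropNull (l :: ls) = l :: dropNull ls := by
  simp [dropNull, h]

@[simp] theorem dropNull_null_cons (ls : List (Loop d)) :
    dropNull (Loop.null :: ls) = dropNull ls := by
  simp [dropNull]

theorem prod_map_dropNull {M : Type*} [Monoid M] {g : Loop d → M} (hg : g Loop.null = 1)
    (ls : List (Loop d)) : ((dropNull ls).map g).prod = (ls.map g).prod := by
  induction ls with
  | nil => rfl
  | cons l ls ih =>
    by_cases h : l = Loop.null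
    · simp [h, hg, ih]
    · simp [dropNull_cons_of_ne h, ih]

namespace LoopSeq

theorem minRep_mk (ls : List (Loop d)) : (mk ls).minRep = dropNull ls := rfl

theorem mk_minRep (s : LoopSeq d) : mk s.minRep = s := by
  induction s using Quotient.inductionOn with
  | h ls =>
    refine Quotient.sound ?_
    change dropNull (dropNull ls) = dropNull ls
    simp [dropNull]

theorem ne_null_of_mem_minRep {s : LoopSeq d} {l : Loop d} (h : l ∈ s.minRep) :
    l ≠ Loop.null := by
  induction s using Quotient.inductionOn with
  | h ls => simpa using (List.mem_filter.mp (show l ∈ dropNull ls from h)).2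

theorem minRep_null : (null : LoopSeq d).minRep = [] := by
  rw [null, minRep_mk, dropNull_null_cons]
  rfl

end LoopSeq

/-! ### Plaquettes -/

theorem mem_plaquettesAt {e : Edge d} {p : List (Edge d)} :
    p ∈ plaquettesAt e ↔ IsPosPlaquette p ∧ (e ∈ p ∨ e.inv ∈ p) := by
  simp [plaquettesAt]

theorem mem_plaquettesIn {Λ : Finset (Fin d → ℤ)} {p : List (Edge d)} :
    p ∈ plaquettesIn Λ ↔ IsPosPlaquette p ∧ ∀ f ∈ p, f.src ∈ Λ ∧ f.tgt ∈ Λ := by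
  simp [plaquettesIn]

theorem plaquettesAt_inv (e : Edge d) : plaquettesAt e.inv = plaquettesAt e := by
  ext p
  rw [mem_plaquettesAt, mem_plaquettesAt, Edge.inv_inv, or_comm (a := e ∈ p)]

theorem IsPosPlaquette.length {p : List (Edge d)} (h : IsPosPlaquette p) : p.length = 4 := by
  obtain ⟨-, -, e₁, e₂, e₃, e₄, rfl, -⟩ := h
  rfl

theorem Edge.ne_of_tgt_eq_src {a b : Edge d} (h : a.tgt = b.src) : a ≠ b := by
  rintro rfl
  exact a.src_ne_tgt h.symm

theorem Edge.ne_of_two_steps {a b c : Edge d} (hab : a.tgt = b.src) (hbc : b.tgt = c.src)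
    (hback : b ≠ a.inv) : a ≠ c := by
  rintro rfl
  exact hback (Edge.ext hab.symm hbc)

theorem Edge.ne_inv_of_two_steps {a b c : Edge d} (hab : a.tgt = b.src) (hbc : b.tgt = c.src) :
    a ≠ c.inv := by
  rintro rfl
  exact b.src_ne_tgt (hab.symm.trans hbc.symm)

theorem IsPosPlaquette.pairwise {p : List (Edge d)} (hp : IsPosPlaquette p) :
    p.Pairwise fun f g => f ≠ g ∧ f ≠ g.inv := by
  obtain ⟨hc, hn, e₁, e₂, e₃, e₄, rfl, -⟩ := hp
  unfold IsClosedPath at hc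
  unfold IsNonbacktracking at hn
  rw [Cycle.chain_coe_cons] at hc hn
  simp only [List.cons_append, List.nil_append, List.isChain_cons_cons, List.isChain_singleton,
    and_true] at hc hn
  obtain ⟨c₁₂, c₂₃, c₃₄, c₄₁⟩ := hc
  obtain ⟨n₁₂, n₂₃, n₃₄, n₄₁⟩ := hn
  have ne_inv_of_ne : ∀ {a b : Edge d}, b ≠ a.inv → a ≠ b.inv := fun h h' => h (by simp [h'])
  simp only [List.pairwise_cons, List.mem_cons, List.not_mem_nil, or_false, forall_eq_or_imp,
    forall_eq, IsEmpty.forall_iff, implies_true, List.Pairwise.nil, and_true]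
  exact ⟨⟨⟨Edge.ne_of_tgt_eq_src c₁₂, ne_inv_of_ne n₁₂⟩,
      ⟨Edge.ne_of_two_steps c₁₂ c₂₃ n₁₂, Edge.ne_inv_of_two_steps c₁₂ c₂₃⟩,
      ⟨(Edge.ne_of_tgt_eq_src c₄₁).symm, n₄₁⟩⟩,
    ⟨⟨Edge.ne_of_tgt_eq_src c₂₃, ne_inv_of_ne n₂₃⟩,
      ⟨Edge.ne_of_two_steps c₂₃ c₃₄ n₂₃, Edge.ne_inv_of_two_steps c₂₃ c₃₄⟩⟩,
    ⟨Edge.ne_of_tgt_eq_src c₃₄, ne_inv_of_ne n₃₄⟩⟩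

section Pairwise

variable {p : List (Edge d)} {f g : Edge d} {x y : ℕ}

theorem eq_of_getElem?_of_pairwise (hp : p.Pairwise fun f g => f ≠ g ∧ f ≠ g.inv)
    (hx : p[x]? = some f) (hy : p[y]? = some g) (hfg : f = g ∨ f = g.inv) : x = y := by
  obtain ⟨hxlt, rfl⟩ := List.getElem?_eq_some_iff.mp hx
  obtain ⟨hylt, rfl⟩ := List.getElem?_eq_some_iff.mp hy
  rw [List.pairwise_iff_getElem] at hp
  rcases lt_trichotomy x y with h | h | h
  · exact absurd hfg (not_or.mpr (hp x y hxlt hylt h))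
  · exact h
  · have hgf := hp y x hylt hxlt h
    exact absurd hfg (not_or.mpr ⟨hgf.1.symm, fun h' => hgf.2 (by rw [h', Edge.inv_inv])⟩)

theorem locs_eq_singleton (hp : p.Pairwise fun f g => f ≠ g ∧ f ≠ g.inv) (hx : p[x]? = some f) :
    locs p f = {x} := by
  ext y
  rw [mem_locs, Finset.mem_singleton]
  exact ⟨fun hy => eq_of_getElem?_of_pairwise hp hy hx (.inl rfl), fun h => h ▸ hx⟩

theorem locs_inv_eq_empty (hp : p.Pairwise fun f g => f ≠ g ∧ f ≠ g.inv) (hx : p[x]? = some f) :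
    locs p f.inv = ∅ := by
  refine Finset.eq_empty_of_forall_notMem fun y hy => ?_
  rw [mem_locs] at hy
  rw [eq_of_getElem?_of_pairwise hp hy hx (.inr rfl), hx] at hy
  exact f.ne_inv (Option.some.inj hy)

end Pairwise

theorem locIn_lt_length {p : List (Edge d)} {e : Edge d} (h : e ∈ p ∨ e.inv ∈ p) :
    locIn p e < p.length := by
  rw [locIn, List.findIdx_lt_length]
  rcases h with h | h <;> exact ⟨_, h, by simp⟩

theorem getElem?_locIn {p : List (Edge d)} {e : Edge d} (h : e ∈ p ∨ e.inv ∈ p) :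
    p[locIn p e]? = some e ∨ p[locIn p e]? = some e.inv := by
  have hlt := locIn_lt_length h
  have hfind : p[locIn p e] = e ∨ p[locIn p e] = e.inv :=
    of_decide_eq_true (List.findIdx_getElem (w := hlt))
  rw [List.getElem?_eq_getElem hlt]
  exact hfind.imp (congrArg some) (congrArg some)

/-- The three edges that complete `e` to the plaquette `p`, traversed along `e`: it is `dc` both
for `p = ced` and for `p⁻¹ = ced`. -/
noncomputable def staple (e : Edge d) (p : List (Edge d)) : List (Edge d) :=
  if p[locIn p e]? = some e then after p (locIn p e) ++ before p (locIn p e)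
  else invPath (before p (locIn p e)) ++ invPath (after p (locIn p e))

theorem posDeform_eq (ρ : List (Edge d)) (e : Edge d) (x : ℕ) (p : List (Edge d)) :
    posDeform ρ e x p = core (before ρ x ++ e :: (staple e p ++ e :: after ρ x)) := by
  unfold posDeform posMerge staple
  split_ifs <;> simp

theorem negDeform_eq (ρ : List (Edge d)) (e : Edge d) (x : ℕ) (p : List (Edge d)) :
    negDeform ρ e x p = core (before ρ x ++ (invPath (staple e p) ++ after ρ x)) := by
  unfold negDeform negMerge staple
  split_ifs <;> simp [invPath_append, invPath_invPath]

section Staple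

variable {e : Edge d} {p : List (Edge d)} (hp : p ∈ plaquettesAt e)

include hp

theorem length_staple : (staple e p).length = 3 := by
  obtain ⟨hpos, he⟩ := mem_plaquettesAt.mp hp
  have hlt := locIn_lt_length he
  have hlen := hpos.length
  unfold staple
  split_ifs <;>
  · simp only [List.length_append, length_invPath, length_before hlt, length_after]
    omega

theorem isWalk_staple : IsWalk e.tgt (staple e p) e.src := by
  obtain ⟨hpos, he⟩ := mem_plaquettesAt.mp hp
  obtain ⟨u, hu⟩ := isClosedPath_iff.mp hpos.1
  unfold staple
  split_ifs with h
  · exact isWalk_append.mpr ⟨u, hu.after h, hu.before h⟩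
  · have h' := (getElem?_locIn he).resolve_left h
    exact isWalk_append.mpr ⟨u, (hu.before h').invPath, (hu.after h').invPath⟩

end Staple

/-! ### The number of plaquettes at an edge -/

theorem IsWalk.abs_sub_le {ρ : List (Edge d)} {u v : Fin d → ℤ} (h : IsWalk u ρ v) {f : Edge d}
    (hf : f ∈ ρ) (i : Fin d) : |f.src i - u i| ≤ ρ.length ∧ |f.tgt i - u i| ≤ ρ.length := by
  induction ρ generalizing u with
  | nil => simp at hf
  | cons g t ih =>
    obtain ⟨rfl, ht⟩ := isWalk_cons.mp h
    have hg := abs_le.mp (g.abs_sub_le i)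
    rw [List.length_cons]
    push_cast
    simp only [abs_le]
    rcases List.mem_cons.mp hf with rfl | hf
    · constructor <;> constructor <;> linarith
    · have hsrc := abs_le.mp (ih ht hf).1
      have htgt := abs_le.mp (ih ht hf).2
      constructor <;> constructor <;> linarith

theorem abs_sub_le_of_mem_plaquettesAt {e : Edge d} {p : List (Edge d)} (hp : p ∈ plaquettesAt e)
    {f : Edge d} (hf : f ∈ p) (i : Fin d) :
    |f.src i - e.src i| ≤ 8 ∧ |f.tgt i - e.src i| ≤ 8 := by
  obtain ⟨hp, he⟩ := mem_plaquettesAt.mp hp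
  obtain ⟨u, hu⟩ := isClosedPath_iff.mp hp.1
  have hlength : (p.length : ℤ) = 4 := mod_cast hp.length
  have hbase : |e.src i - u i| ≤ 4 := by
    rw [← hlength]
    exact he.elim (fun he => (hu.abs_sub_le he i).1) fun he => (hu.abs_sub_le he i).2
  have hsrc := (hu.abs_sub_le hf i).1
  have htgt := (hu.abs_sub_le hf i).2
  rw [hlength] at hsrc htgt
  simp only [abs_le] at *
  constructor <;> constructor <;> linarith

/-- The translate of an edge by the vector `v`. -/
def Edge.shift (v : Fin d → ℤ) (e : Edge d) : Edge d where
  src := e.src + v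
  tgt := e.tgt + v
  adj := by simpa only [Pi.add_apply, add_sub_add_right_eq_sub] using e.adj

theorem Edge.shift_injective (v : Fin d → ℤ) : Function.Injective (Edge.shift v) := fun _ _ h =>
  Edge.ext (add_right_cancel (congrArg Edge.src h)) (add_right_cancel (congrArg Edge.tgt h))

theorem exists_card_plaquettesAt_le (d : ℕ) : ∃ P : ℕ, ∀ e : Edge d, (plaquettesAt e).card ≤ P := by
  refine ⟨(finite_paths (Finset.Icc (fun _ : Fin d => -8) (fun _ => 8)) 4).toFinset.card,
    fun e => Finset.card_le_card_of_injOn (List.map (Edge.shift (-e.src))) (fun p hp => ?_)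
      (List.map_injective_iff.mpr (Edge.shift_injective _)).injOn⟩
  have hpos : IsPosPlaquette p := (mem_plaquettesAt.mp hp).1
  simp only [Set.Finite.coe_toFinset, Set.mem_ofPred_eq, List.length_map, hpos.length,
    List.mem_map, forall_exists_index, and_imp, forall_apply_eq_imp_iff₂, Finset.mem_Icc,
    true_and]
  refine fun f hf => ⟨⟨fun i => ?_, fun i => ?_⟩, fun i => ?_, fun i => ?_⟩ <;>
  · have hfi := abs_sub_le_of_mem_plaquettesAt hp hf i
    simp only [abs_le] at hfi
    simp only [Edge.shift, Pi.add_apply, Pi.neg_apply]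
    linarith

/-! ### Weights of loops -/

section LoopWeight

variable {K : ℝ}

/-- The weight of a loop of length `n` in the contraction argument. The factor `1 / n ^ 2` makes the
weights of all splittings of a loop summable against the weight of the loop itself; the null loop
has weight `1`, so that the weight of a loop sequence does not depend on its representative. -/
noncomputable def loopWeight (K : ℝ) (n : ℕ) : ℝ := if n = 0 then 1 else K ^ n / (64 * (n : ℝ) ^ 2)

theorem loopWeight_zero (K : ℝ) : loopWeight K 0 = 1 := if_pos rfl

theorem loopWeight_of_pos (K : ℝ) {n : ℕ} (hn : 0 < n) :
    loopWeight K n = K ^ n / (64 * (n : ℝ) ^ 2) := if_neg hn.ne'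

theorem loopWeight_pos (hK : 0 < K) (n : ℕ) : 0 < loopWeight K n := by
  rcases n.eq_zero_or_pos with rfl | hn
  · rw [loopWeight_zero]; exact one_pos
  · rw [loopWeight_of_pos K hn]; positivity

theorem loopWeight_mono (hK : 64 ≤ K) : Monotone (loopWeight K) := by
  refine monotone_nat_of_le_succ fun n => ?_
  rcases n.eq_zero_or_pos with rfl | hn
  · rw [loopWeight_zero, loopWeight_of_pos K (Nat.succ_pos 0)]
    norm_num
    linarith
  · rw [loopWeight_of_pos K hn, loopWeight_of_pos K n.succ_pos,
      div_le_div_iff₀ (by positivity) (by positivity), pow_succ]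
    have h1 : (1 : ℝ) ≤ n := mod_cast hn
    have hsucc : ((n + 1 : ℕ) : ℝ) ^ 2 ≤ K * (n : ℝ) ^ 2 := by push_cast; nlinarith
    calc K ^ n * (64 * ((n + 1 : ℕ) : ℝ) ^ 2) ≤ K ^ n * (64 * (K * (n : ℝ) ^ 2)) := by gcongr
      _ = K ^ n * K * (64 * (n : ℝ) ^ 2) := by ring

theorem loopWeight_add_le (hK : 1 ≤ K) {n : ℕ} (hn : 0 < n) (k : ℕ) :
    loopWeight K (n + k) ≤ K ^ k * loopWeight K n := by
  rw [loopWeight_of_pos K hn, loopWeight_of_pos K (by omega), pow_add, mul_comm (K ^ n),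
    ← mul_div_assoc]
  gcongr
  omega

theorem pow_le_loopWeight {L : ℝ} (hL : 0 ≤ L) (n : ℕ) : L ^ n ≤ loopWeight (256 * L) n := by
  rcases n.eq_zero_or_pos with rfl | hn
  · rw [loopWeight_zero, pow_zero]
  · rw [loopWeight_of_pos _ hn, le_div_iff₀ (by positivity), mul_pow, mul_comm]
    gcongr
    have h256 : (256 : ℝ) ^ n = (16 ^ n) ^ 2 := by rw [← pow_mul, mul_comm, pow_mul]; norm_num
    have hbernoulli : 8 * (n : ℝ) ≤ 16 ^ n := by
      have h := one_add_mul_le_pow (a := (15 : ℝ)) (by norm_num) n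
      norm_num at h
      linarith [(n.cast_nonneg : (0 : ℝ) ≤ n)]
    rw [h256]
    calc 64 * (n : ℝ) ^ 2 = (8 * (n : ℝ)) ^ 2 := by ring
      _ ≤ (16 ^ n) ^ 2 := by gcongr

theorem sum_inv_sq_le_two {ι : Type*} {s : Finset ι} {k : ι → ℕ} (hk : Set.InjOn k s)
    (hpos : ∀ i ∈ s, 0 < k i) : ∑ i ∈ s, ((k i : ℝ) ^ 2)⁻¹ ≤ 2 := by
  rw [← Finset.sum_image (f := fun n : ℕ => ((n : ℝ) ^ 2)⁻¹) hk]
  have hsub : s.image k ⊆ Finset.Ioo 0 ((s.image k).sup id + 1) := fun n hn => by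
    obtain ⟨i, hi, rfl⟩ := Finset.mem_image.mp hn
    exact Finset.mem_Ioo.mpr ⟨hpos i hi, Nat.lt_succ_of_le (Finset.le_sup (f := id) hn)⟩
  refine (Finset.sum_le_sum_of_subset_of_nonneg hsub fun _ _ _ => by positivity).trans ?_
  simpa using sum_Ioo_inv_sq_le (α := ℝ) 0 ((s.image k).sup id + 1)

theorem loopWeight_mul_le (hK : 0 ≤ K) {a b : ℕ} (ha : 0 < a) (hb : 0 < b) :
    loopWeight K a * loopWeight K b ≤
      loopWeight K (a + b) / 32 * (((a : ℝ) ^ 2)⁻¹ + ((b : ℝ) ^ 2)⁻¹) := by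
  rw [loopWeight_of_pos K ha, loopWeight_of_pos K hb, loopWeight_of_pos K (by omega), pow_add]
  have hsq : ((a + b : ℕ) : ℝ) ^ 2 ≤ 2 * ((a : ℝ) ^ 2 + (b : ℝ) ^ 2) := by
    push_cast
    linarith [sq_nonneg ((a : ℝ) - b)]
  calc K ^ a / (64 * (a : ℝ) ^ 2) * (K ^ b / (64 * (b : ℝ) ^ 2))
      = K ^ a * K ^ b / (64 * 64 * (a : ℝ) ^ 2 * (b : ℝ) ^ 2) := by field_simp
    _ = K ^ a * K ^ b / (64 * 64 * (a : ℝ) ^ 2 * (b : ℝ) ^ 2) *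
          (((a + b : ℕ) : ℝ) ^ 2 / ((a + b : ℕ) : ℝ) ^ 2) := by
        rw [div_self (by positivity), mul_one]
    _ ≤ K ^ a * K ^ b / (64 * 64 * (a : ℝ) ^ 2 * (b : ℝ) ^ 2) *
          (2 * ((a : ℝ) ^ 2 + (b : ℝ) ^ 2) / ((a + b : ℕ) : ℝ) ^ 2) := by gcongr
    _ = _ := by field_simp; ring

theorem sum_loopWeight_mul_le (hK : 0 < K) {n : ℕ} {ι : Type*} {s : Finset ι} {k : ι → ℕ}
    (hk : Set.InjOn k s) (hpos : ∀ i ∈ s, 0 < k i) (hlt : ∀ i ∈ s, k i < n) :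
    ∑ i ∈ s, loopWeight K (n - k i) * loopWeight K (k i) ≤ loopWeight K n / 8 := by
  have hk' : Set.InjOn (fun i => n - k i) s := fun i hi j hj hij => by
    have := hlt i hi
    have := hlt j hj
    exact hk hi hj (by dsimp only at hij; omega)
  have hsum := add_le_add (sum_inv_sq_le_two hk' fun i hi => Nat.sub_pos_of_lt (hlt i hi))
    (sum_inv_sq_le_two hk hpos)
  rw [← Finset.sum_add_distrib] at hsum
  calc ∑ i ∈ s, loopWeight K (n - k i) * loopWeight K (k i)
      ≤ ∑ i ∈ s, loopWeight K n / 32 * ((((n - k i : ℕ) : ℝ) ^ 2)⁻¹ + ((k i : ℝ) ^ 2)⁻¹) := by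
        refine Finset.sum_le_sum fun i hi => ?_
        have h := loopWeight_mul_le hK.le (Nat.sub_pos_of_lt (hlt i hi)) (hpos i hi)
        rwa [Nat.sub_add_cancel (hlt i hi).le] at h
    _ = loopWeight K n / 32 * ∑ i ∈ s, ((((n - k i : ℕ) : ℝ) ^ 2)⁻¹ + ((k i : ℝ) ^ 2)⁻¹) :=
        (Finset.mul_sum ..).symm
    _ ≤ loopWeight K n / 32 * (2 + 2) := by
        have := loopWeight_pos hK n
        gcongr
    _ = loopWeight K n / 8 := by ring

theorem sum_loopWeight_dist_le (hK : 0 < K) {n x : ℕ} (hx : x < n) :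
    ∑ y ∈ (Finset.range n).erase x, loopWeight K (n - x.dist y) * loopWeight K (x.dist y) ≤
      loopWeight K n / 4 := by
  have hlt : ∀ y ∈ (Finset.range n).erase x, 0 < x.dist y ∧ x.dist y < n := fun y hy => by
    have := Finset.mem_erase.mp hy
    have := Finset.mem_range.mp this.2
    unfold Nat.dist
    omega
  rw [← Finset.sum_filter_add_sum_filter_not _ (· < x)]
  have hbelow := sum_loopWeight_mul_le hK (n := n) (k := x.dist)
    (s := ((Finset.range n).erase x).filter (· < x))
    (fun y hy z hz h => by
      simp only [Finset.coe_filter, Set.mem_ofPred_eq, Nat.dist] at hy hz h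
      omega)
    (fun y hy => (hlt y (Finset.mem_of_mem_filter y hy)).1)
    (fun y hy => (hlt y (Finset.mem_of_mem_filter y hy)).2)
  have habove := sum_loopWeight_mul_le hK (n := n) (k := x.dist)
    (s := ((Finset.range n).erase x).filter (¬ · < x))
    (fun y hy z hz h => by
      simp only [Finset.coe_filter, Set.mem_ofPred_eq, Nat.dist] at hy hz h
      omega)
    (fun y hy => (hlt y (Finset.mem_of_mem_filter y hy)).1)
    (fun y hy => (hlt y (Finset.mem_of_mem_filter y hy)).2)
  linarith

end LoopWeight

/-! ### Contraction and uniqueness -/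

section Contraction

variable {K : ℝ}

theorem loopWeight_core_mul_le (hK : 64 ≤ K) {a b : List (Edge d)} {n k : ℕ} (ha : a.length ≤ n)
    (hb : b.length ≤ k) :
    loopWeight K (core a).length * loopWeight K (core b).length ≤
      loopWeight K n * loopWeight K k := by
  have hpos := fun m => (loopWeight_pos (by linarith : 0 < K) m).le
  exact mul_le_mul (loopWeight_mono hK ((length_core_le a).trans ha))
    (loopWeight_mono hK ((length_core_le b).trans hb)) (hpos _) (hpos _)

theorem loopWeight_negSplit_le (hK : 64 ≤ K) {ρ : List (Edge d)} {x y : ℕ} (hx : x < ρ.length)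
    (hy : y < ρ.length) :
    loopWeight K (negSplit ρ x y).1.length * loopWeight K (negSplit ρ x y).2.length ≤
      loopWeight K (ρ.length - x.dist y) * loopWeight K (x.dist y) := by
  unfold negSplit Nat.dist
  split_ifs with hxy
  · refine loopWeight_core_mul_le hK ?_ ?_ <;>
      simp only [List.length_append, length_before hx, length_after, length_between hy] <;> omega
  · rw [mul_comm]
    refine loopWeight_core_mul_le hK ?_ ?_ <;>
      simp only [List.length_append, length_before hy, length_after, length_between hx] <;> omega

theorem loopWeight_posSplit_le (hK : 64 ≤ K) {ρ : List (Edge d)} (e : Edge d) {x y : ℕ}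
    (hx : x < ρ.length) (hy : y < ρ.length) (hne : x ≠ y) :
    loopWeight K (posSplit ρ e x y).1.length * loopWeight K (posSplit ρ e x y).2.length ≤
      loopWeight K (ρ.length - x.dist y) * loopWeight K (x.dist y) := by
  unfold posSplit Nat.dist
  split_ifs with hxy
  · refine loopWeight_core_mul_le hK ?_ ?_ <;>
      simp only [List.length_append, List.length_cons, List.length_nil, length_before hx,
        length_after, length_between hy] <;> omega
  · rw [mul_comm]
    refine loopWeight_core_mul_le hK ?_ ?_ <;>
      simp only [List.length_append, List.length_cons, List.length_nil, length_before hy,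
        length_after, length_between hx] <;> omega

theorem length_posDeform_le {ρ p : List (Edge d)} {e : Edge d} {x : ℕ} (hx : x < ρ.length)
    (hp : p ∈ plaquettesAt e) : (posDeform ρ e x p).length ≤ ρ.length + 4 := by
  rw [posDeform_eq]
  refine (length_core_le _).trans ?_
  simp only [List.length_append, List.length_cons, length_staple hp, length_before hx,
    length_after]
  omega

theorem length_negDeform_le {ρ p : List (Edge d)} {e : Edge d} {x : ℕ} (hx : x < ρ.length)
    (hp : p ∈ plaquettesAt e) : (negDeform ρ e x p).length ≤ ρ.length + 4 := by
  rw [negDeform_eq]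
  refine (length_core_le _).trans ?_
  simp only [List.length_append, length_invPath, length_staple hp, length_before hx, length_after]
  omega

/-- The weight of a loop sequence, the product of the weights of its loops. The contraction argument
takes place in the norm `sup |φ s| / s.weight K`. -/
noncomputable def LoopSeq.weight (K : ℝ) (s : LoopSeq d) : ℝ :=
  (s.minRep.map fun l => loopWeight K l.length).prod

theorem LoopSeq.weight_mk_cons (K : ℝ) (l : Loop d) (ls : List (Loop d)) :
    (mk (l :: ls)).weight K = loopWeight K l.length * (mk ls).weight K := by
  have weight_mk (ls : List (Loop d)) :
      (mk ls).weight K = (ls.map fun l => loopWeight K l.length).prod :=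
    prod_map_dropNull (g := fun l => loopWeight K l.length) (loopWeight_zero K) ls
  rw [weight_mk, weight_mk, List.map_cons, List.prod_cons]

theorem LoopSeq.pow_length_le_weight {L : ℝ} (hL : 0 ≤ L) (s : LoopSeq d) :
    L ^ s.length ≤ s.weight (256 * L) := by
  unfold LoopSeq.length LoopSeq.weight
  induction s.minRep with
  | nil => simp
  | cons l ls ih =>
    rw [List.map_cons, List.sum_cons, pow_add, List.map_cons, List.prod_cons]
    have h := pow_le_loopWeight hL l.length
    exact mul_le_mul h ih (by positivity) ((pow_nonneg hL _).trans h)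

/-- The contribution of the location `x` of the path `ρ`, at which the edge `e` occurs, to the
right-hand side of the master loop equation. -/
noncomputable def locTerm (β : ℝ) (φ : LoopSeq d → ℝ) (ρ : List (Edge d)) (e : Edge d)
    (ls : List (Loop d)) (x : ℕ) : ℝ :=
  ∑ y ∈ locs ρ e.inv, φ (.mk ((negSplit ρ x y).1 :: (negSplit ρ x y).2 :: ls))
    - ∑ y ∈ (locs ρ e).erase x, φ (.mk ((posSplit ρ e x y).1 :: (posSplit ρ e x y).2 :: ls))
    + β * ∑ p ∈ plaquettesAt e,
        (φ (.mk (negDeform ρ e x p :: ls)) - φ (.mk (posDeform ρ e x p :: ls)))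

theorem sum_locTerm_add_sum_locTerm_inv (β : ℝ) (φ : LoopSeq d → ℝ) (ρ : List (Edge d))
    (e : Edge d) (ls : List (Loop d)) :
    ∑ x ∈ locs ρ e, locTerm β φ ρ e ls x + ∑ x ∈ locs ρ e.inv, locTerm β φ ρ e.inv ls x =
      splittingTerm φ ρ e ls + deformationTerm β φ ρ e ls := by
  simp only [locTerm, splittingTerm, deformationTerm, Finset.sum_add_distrib,
    Finset.sum_sub_distrib, Edge.inv_inv, plaquettesAt_inv, ← Finset.mul_sum]
  simp only [Finset.sum_comm (t := plaquettesAt e)]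
  ring

variable {M : ℝ} {D : LoopSeq d → ℝ}

theorem locs_inv_union_locs_erase_subset {ρ : List (Edge d)} {e : Edge d} {x : ℕ}
    (hx : ρ[x]? = some e) :
    locs ρ e.inv ∪ (locs ρ e).erase x ⊆ (Finset.range ρ.length).erase x := by
  refine Finset.union_subset (fun y hy => Finset.mem_erase.mpr ⟨?_, Finset.mem_of_mem_filter y hy⟩)
    (Finset.erase_subset_erase _ (Finset.filter_subset _ _))
  rintro rfl
  exact Finset.disjoint_left.mp (disjoint_locs_inv ρ e) (mem_locs.mpr hx) hy

theorem abs_sum_splits_le (hK : 64 ≤ K) (hD : ∀ s, |D s| ≤ M * s.weight K) {ρ : List (Edge d)}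
    {e : Edge d} {x : ℕ} (hx : ρ[x]? = some e) (ls : List (Loop d)) :
    |∑ y ∈ locs ρ e.inv, D (.mk ((negSplit ρ x y).1 :: (negSplit ρ x y).2 :: ls))
      - ∑ y ∈ (locs ρ e).erase x, D (.mk ((posSplit ρ e x y).1 :: (posSplit ρ e x y).2 :: ls))| ≤
      M * (LoopSeq.mk ls).weight K * (loopWeight K ρ.length / 4) := by
  have hK0 : 0 < K := by linarith
  have hxρ : x < ρ.length := (List.getElem?_eq_some_iff.mp hx).1
  have hlt {f : Edge d} {y : ℕ} (hy : y ∈ locs ρ f) : y < ρ.length :=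
    Finset.mem_range.mp (Finset.mem_filter.mp hy).1
  set c := M * (LoopSeq.mk ls).weight K
  have hc : 0 ≤ c := (abs_nonneg _).trans (hD _)
  set W : ℕ → ℝ := fun y => loopWeight K (ρ.length - x.dist y) * loopWeight K (x.dist y)
  have hDpair {l l' : Loop d} {w : ℝ} (h : loopWeight K l.length * loopWeight K l'.length ≤ w) :
      |D (.mk (l :: l' :: ls))| ≤ c * w := by
    refine (hD _).trans (le_trans (le_of_eq ?_) (mul_le_mul_of_nonneg_left h hc))
    rw [LoopSeq.weight_mk_cons, LoopSeq.weight_mk_cons]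
    ring
  have hneg : |∑ y ∈ locs ρ e.inv, D (.mk ((negSplit ρ x y).1 :: (negSplit ρ x y).2 :: ls))| ≤
      ∑ y ∈ locs ρ e.inv, c * W y :=
    (Finset.abs_sum_le_sum_abs _ _).trans (Finset.sum_le_sum fun y hy =>
      hDpair (loopWeight_negSplit_le hK hxρ (hlt hy)))
  have hpos : |∑ y ∈ (locs ρ e).erase x,
        D (.mk ((posSplit ρ e x y).1 :: (posSplit ρ e x y).2 :: ls))| ≤
      ∑ y ∈ (locs ρ e).erase x, c * W y :=
    (Finset.abs_sum_le_sum_abs _ _).trans (Finset.sum_le_sum fun y hy =>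
      hDpair (loopWeight_posSplit_le hK e hxρ (hlt (Finset.mem_of_mem_erase hy))
        (Finset.ne_of_mem_erase hy).symm))
  have hdisj : Disjoint (locs ρ e.inv) ((locs ρ e).erase x) :=
    (disjoint_locs_inv ρ e).symm.mono_right (Finset.erase_subset _ _)
  calc _ ≤ ∑ y ∈ locs ρ e.inv ∪ (locs ρ e).erase x, c * W y := by
        rw [Finset.sum_union hdisj]
        exact (abs_sub _ _).trans (add_le_add hneg hpos)
    _ ≤ ∑ y ∈ (Finset.range ρ.length).erase x, c * W y :=
        Finset.sum_le_sum_of_subset_of_nonneg (locs_inv_union_locs_erase_subset hx) fun y _ _ =>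
          mul_nonneg hc (mul_pos (loopWeight_pos hK0 _) (loopWeight_pos hK0 _)).le
    _ ≤ c * (loopWeight K ρ.length / 4) := by
        rw [← Finset.mul_sum]
        exact mul_le_mul_of_nonneg_left (sum_loopWeight_dist_le hK0 hxρ) hc

theorem abs_sum_deforms_le (hK : 64 ≤ K) (hD : ∀ s, |D s| ≤ M * s.weight K) {ρ : List (Edge d)}
    {e : Edge d} {x : ℕ} (hx : x < ρ.length) (ls : List (Loop d)) :
    |∑ p ∈ plaquettesAt e,
        (D (.mk (negDeform ρ e x p :: ls)) - D (.mk (posDeform ρ e x p :: ls)))| ≤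
      (plaquettesAt e).card *
        (2 * (M * (LoopSeq.mk ls).weight K * (K ^ 4 * loopWeight K ρ.length))) := by
  have hDcons {l : Loop d} (hl : l.length ≤ ρ.length + 4) : |D (.mk (l :: ls))| ≤
      M * (LoopSeq.mk ls).weight K * (K ^ 4 * loopWeight K ρ.length) := by
    refine (hD _).trans ?_
    rw [LoopSeq.weight_mk_cons, mul_comm (loopWeight K _), ← mul_assoc]
    refine mul_le_mul_of_nonneg_left ?_ ((abs_nonneg _).trans (hD _))
    exact (loopWeight_mono hK hl).trans (loopWeight_add_le (by linarith) (by omega) 4)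
  refine (Finset.abs_sum_le_sum_abs _ _).trans ?_
  rw [← nsmul_eq_mul]
  refine Finset.sum_le_card_nsmul _ _ _ fun p hp => (abs_sub _ _).trans ?_
  linarith [hDcons (length_negDeform_le hx hp), hDcons (length_posDeform_le hx hp)]

theorem abs_locTerm_le (hK : 64 ≤ K) (hD : ∀ s, |D s| ≤ M * s.weight K) {ρ : List (Edge d)}
    {e : Edge d} {β : ℝ} (hβ : 8 * (|β| * (plaquettesAt e).card * K ^ 4) ≤ 1) {x : ℕ}
    (hx : ρ[x]? = some e) (ls : List (Loop d)) :
    |locTerm β D ρ e ls x| ≤ M / 2 * (loopWeight K ρ.length * (LoopSeq.mk ls).weight K) := by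
  have hsplit := abs_sum_splits_le hK hD hx ls
  have hdeform := abs_sum_deforms_le hK hD (List.getElem?_eq_some_iff.mp hx).1 ls (e := e)
  set c := M * (LoopSeq.mk ls).weight K with hc_def
  have hc : 0 ≤ c * loopWeight K ρ.length :=
    mul_nonneg ((abs_nonneg _).trans (hD _)) (loopWeight_pos (by linarith) _).le
  calc |locTerm β D ρ e ls x|
      ≤ c * (loopWeight K ρ.length / 4) +
          |β| * ((plaquettesAt e).card * (2 * (c * (K ^ 4 * loopWeight K ρ.length)))) := by
        refine (abs_add_le _ _).trans (add_le_add hsplit ?_)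
        rw [abs_mul]
        exact mul_le_mul_of_nonneg_left hdeform (abs_nonneg β)
    _ = c * loopWeight K ρ.length / 4 +
          8 * (|β| * (plaquettesAt e).card * K ^ 4) * (c * loopWeight K ρ.length) / 4 := by ring
    _ ≤ c * loopWeight K ρ.length / 4 + 1 * (c * loopWeight K ρ.length) / 4 := by gcongr
    _ = M / 2 * (loopWeight K ρ.length * (LoopSeq.mk ls).weight K) := by rw [hc_def]; ring

theorem MasterLoopEq.abs_le_half {R : FirstEdgeRule d} {β : ℝ} (hDeq : MasterLoopEq R β D)
    (hnull : D LoopSeq.null = 0) (hK : 64 ≤ K)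
    (hβ : ∀ e : Edge d, 8 * (|β| * (plaquettesAt e).card * K ^ 4) ≤ 1)
    (hD : ∀ s, |D s| ≤ M * s.weight K) (s : LoopSeq d) : |D s| ≤ M / 2 * s.weight K := by
  rcases hs : s.minRep with _ | ⟨l, ls⟩
  · have hs_null : s = LoopSeq.null := by
      rw [← LoopSeq.mk_minRep s, hs, ← LoopSeq.minRep_null, LoopSeq.mk_minRep]
    have := (abs_nonneg _).trans (hD s)
    rw [hs_null, hnull, abs_zero, ← hs_null]
    linarith
  · have hl : 0 < (R.path l).length := by
      rw [← Loop.length_eq (R.path_mem l)]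
      exact Loop.length_pos (LoopSeq.ne_null_of_mem_minRep (s := s) (by simp [hs]))
    obtain ⟨e, τ, hρ⟩ := List.exists_cons_of_length_pos hl
    set ρ := R.path l with hρ_def
    have hcard : (0 : ℝ) < (locs ρ e ∪ locs ρ e.inv).card := by
      rw [Nat.cast_pos, Finset.card_pos]
      exact ⟨0, Finset.mem_union_left _ (mem_locs.mpr (by rw [hρ]; rfl))⟩
    have hsum (f : Edge d) : |∑ x ∈ locs ρ f, locTerm β D ρ f ls x| ≤
        (locs ρ f).card * (M / 2 * s.weight K) := by
      refine (Finset.abs_sum_le_sum_abs _ _).trans ?_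
      rw [← nsmul_eq_mul, ← LoopSeq.mk_minRep s, hs, LoopSeq.weight_mk_cons,
        Loop.length_eq (R.path_mem l)]
      exact Finset.sum_le_card_nsmul _ _ _ fun x hx => abs_locTerm_le hK hD (hβ f)
        (mem_locs.mp hx) ls
    refine le_of_mul_le_mul_left ?_ hcard
    rw [← abs_of_pos hcard, ← abs_mul, abs_of_pos hcard, hDeq s l ls hs e τ hρ, ← hρ_def,
      ← sum_locTerm_add_sum_locTerm_inv, Finset.card_union_of_disjoint (disjoint_locs_inv ρ e),
      Nat.cast_add, add_mul]
    exact (abs_add_le _ _).trans (add_le_add (hsum e) (hsum e.inv))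

end Contraction

theorem MasterLoopEq.sub {R : FirstEdgeRule d} {β : ℝ} {φ ψ : LoopSeq d → ℝ}
    (hφ : MasterLoopEq R β φ) (hψ : MasterLoopEq R β ψ) : MasterLoopEq R β (φ - ψ) := by
  intro s l ls hs e τ hρ
  rw [Pi.sub_apply, mul_sub, hφ s l ls hs e τ hρ, hψ s l ls hs e τ hρ]
  simp only [splittingTerm, deformationTerm, Pi.sub_apply, Finset.sum_sub_distrib,
    Finset.sum_add_distrib]
  ring

theorem IsMasterSolution.eq {R : FirstEdgeRule d} {L β : ℝ} {φ ψ : LoopSeq d → ℝ} (hL : 1 ≤ L)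
    (hβ : ∀ e : Edge d, 8 * (|β| * (plaquettesAt e).card * (256 * L) ^ 4) ≤ 1)
    (hφ : IsMasterSolution R L β φ) (hψ : IsMasterSolution R L β ψ) : φ = ψ := by
  have hiter (k : ℕ) : ∀ s, |(φ - ψ) s| ≤ 2 * (1 / 2) ^ k * s.weight (256 * L) := by
    induction k with
    | zero =>
      intro s
      have hweight := s.pow_length_le_weight (by linarith : 0 ≤ L)
      have htriangle := abs_sub (φ s) (ψ s)
      rw [pow_zero, Pi.sub_apply]
      linarith [hφ.bound s, hψ.bound s]
    | succ k ih =>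
      have hhalf := (hφ.master.sub hψ.master).abs_le_half
        (by rw [Pi.sub_apply, hφ.null, hψ.null, sub_self]) (by linarith) hβ ih
      simpa only [pow_succ, mul_one_div, mul_div_assoc] using hhalf
  have hzero (r : ℝ) : Tendsto (fun k : ℕ => 2 * (1 / 2 : ℝ) ^ k * r) atTop (𝓝 0) := by
    simpa only [mul_zero, zero_mul] using
      ((tendsto_pow_atTop_nhds_zero_of_lt_one (by norm_num) (by norm_num)).const_mul 2).mul_const r
  funext s
  exact sub_eq_zero.mp (abs_nonpos_iff.mp (ge_of_tendsto' (hzero _) fun k => hiter k s))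

theorem exists_beta_forall_isMasterSolution_eq (d : ℕ) {L : ℝ} (hL : 1 ≤ L) :
    ∃ β₀ : ℝ, 0 < β₀ ∧ ∀ β : ℝ, |β| ≤ β₀ → ∀ (R : FirstEdgeRule d) (φ ψ : LoopSeq d → ℝ),
      IsMasterSolution R L β φ → IsMasterSolution R L β ψ → φ = ψ := by
  obtain ⟨P, hP⟩ := exists_card_plaquettesAt_le d
  refine ⟨1 / (8 * ((P + 1) * (256 * L) ^ 4)), by positivity, fun β hβ R φ ψ hφ hψ =>
    hφ.eq hL (fun e => ?_) hψ⟩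
  have hcard : ((plaquettesAt e).card : ℝ) ≤ P + 1 := by
    exact_mod_cast (hP e).trans P.le_succ
  calc 8 * (|β| * (plaquettesAt e).card * (256 * L) ^ 4)
      ≤ 8 * (|β| * (P + 1) * (256 * L) ^ 4) := by gcongr
    _ = |β| * (8 * ((P + 1) * (256 * L) ^ 4)) := by ring
    _ ≤ 1 := (le_div_iff₀ (by positivity)).mp hβ

section GaugeTheory

variable {Λ : Finset (Fin d → ℤ)} {N : ℕ}

/-! ### Holonomies and Wilson loops -/

theorem edgeVar_inv (Q : Config Λ N) (e : Edge d) : edgeVar Q e.inv = (edgeVar Q e)⁻¹ := by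
  have not_both : e.inv.IsPos → ¬e.IsPos := e.isPos_inv_iff.mp
  unfold edgeVar
  by_cases hpos : e.IsPos
  · have hneg : ¬e.inv.IsPos := fun h => not_both h hpos
    by_cases hmem : e.src ∈ Λ ∧ e.tgt ∈ Λ <;> simp [hpos, hneg, hmem]
  · have hneg : e.inv.IsPos := e.isPos_inv_iff.mpr hpos
    by_cases hmem : e.tgt ∈ Λ ∧ e.src ∈ Λ <;> simp [hpos, hneg, hmem]

/-- The holonomy `Q_{e₁} ⋯ Q_{eₙ}` of a path, whose trace is the Wilson variable. -/
noncomputable def hol (Q : Config Λ N) (ρ : List (Edge d)) : SO N := (ρ.map (edgeVar Q)).prod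

@[simp] theorem hol_nil (Q : Config Λ N) : hol Q [] = 1 := rfl

@[simp] theorem hol_cons (Q : Config Λ N) (e : Edge d) (ρ : List (Edge d)) :
    hol Q (e :: ρ) = edgeVar Q e * hol Q ρ := by simp [hol]

@[simp] theorem hol_append (Q : Config Λ N) (ρ ρ' : List (Edge d)) :
    hol Q (ρ ++ ρ') = hol Q ρ * hol Q ρ' := by simp [hol]

@[simp] theorem hol_invPath (Q : Config Λ N) (ρ : List (Edge d)) :
    hol Q (invPath ρ) = (hol Q ρ)⁻¹ := by
  induction ρ with
  | nil => simp [invPath]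
  | cons f t ih => simp [invPath_cons, ih, edgeVar_inv]

theorem pathTrace_eq (Q : Config Λ N) (ρ : List (Edge d)) :
    pathTrace Q ρ = (hol Q ρ).1.trace := rfl

@[simp] theorem pathTrace_nil (Q : Config Λ N) : pathTrace Q [] = N := by simp [pathTrace_eq]

theorem pathTrace_append_comm (Q : Config Λ N) (ρ ρ' : List (Edge d)) :
    pathTrace Q (ρ ++ ρ') = pathTrace Q (ρ' ++ ρ) :=
  pathTrace_rotated Q List.isRotated_append

theorem Erase.pathTrace_eq {ρ ρ' : List (Edge d)} (h : Erase ρ ρ') (Q : Config Λ N) :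
    pathTrace Q ρ = pathTrace Q ρ' := by
  cases h with
  | interior a b e => simp [LatticeGauge.pathTrace_eq, edgeVar_inv]
  | terminal b e =>
    rw [← List.cons_append, pathTrace_append_comm]
    simp [LatticeGauge.pathTrace_eq, edgeVar_inv]

theorem wilson_eq {l : Loop d} {ρ : List (Edge d)} (h : (ρ : Cycle (Edge d)) = l.1)
    (Q : Config Λ N) : wilson Q l = pathTrace Q ρ := by
  rw [wilson, ← h]
  rfl

theorem wilson_null (Q : Config Λ N) : wilson Q Loop.null = N := by
  rw [wilson_eq (ρ := []) rfl, pathTrace_nil]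

theorem wilson_core {ρ : List (Edge d)} (hρ : IsClosedPath ρ) (Q : Config Λ N) :
    wilson Q (core ρ) = pathTrace Q ρ := by
  obtain ⟨ρ', herase, hcore⟩ := isCore_core hρ
  rw [wilson_eq hcore.symm]
  clear hρ hcore
  induction herase with
  | refl => rfl
  | tail _ hstep ih => rw [← hstep.pathTrace_eq, ih]

/-! ### Haar measure -/

instance (N : ℕ) : SecondCountableTopology (SO N) :=
  have : SecondCountableTopology (Matrix (Fin N) (Fin N) ℝ) :=
    inferInstanceAs (SecondCountableTopology (Fin N → Fin N → ℝ))
  TopologicalSpace.Subtype.secondCountableTopology _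

instance (N : ℕ) : (haarSO N).IsHaarMeasure := by unfold haarSO; infer_instance

instance (N : ℕ) : IsProbabilityMeasure (haarSO N) := ⟨Measure.haarMeasure_self⟩

instance (N : ℕ) : (haarSO N).IsMulRightInvariant := ⟨fun g =>
  have : IsProbabilityMeasure ((haarSO N).map (· * g)) :=
    Measure.isProbabilityMeasure_map (measurable_mul_const g).aemeasurable
  Measure.isHaarMeasure_eq_of_isProbabilityMeasure _ _⟩

/-- The product of the Haar measures, the reference measure of the gauge theory. -/
noncomputable abbrev haarConfig (Λ : Finset (Fin d → ℤ)) (N : ℕ) : Measure (Config Λ N) :=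
  Measure.pi fun _ : PosEdgeIn Λ => haarSO N

theorem integrable_of_continuous {μ : Measure (Config Λ N)} [IsFiniteMeasure μ]
    {E : Type*} [NormedAddCommGroup E] {F : Config Λ N → E} (hF : Continuous F) :
    Integrable F μ :=
  hF.integrable_of_hasCompactSupport (HasCompactSupport.of_compactSpace F)

/-! ### One-parameter subgroups of `SO(N)` -/

namespace SO

open scoped Matrix.Norms.L2Operator

theorem coe_inv_eq_transpose (A : SO N) : (A⁻¹).1 = A.1.transpose := by
  rw [SO.coe_inv, Matrix.star_eq_conjTranspose, Matrix.conjTranspose_eq_transpose_of_trivial]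

theorem abs_apply_le (A : SO N) (i j : Fin N) : |A.1 i j| ≤ 1 :=
  entry_norm_bound_of_unitary (𝕜 := ℝ) (Matrix.mem_specialOrthogonalGroup_iff.mp A.2).1 i j

theorem abs_trace_le (A : SO N) : |A.1.trace| ≤ N :=
  calc |A.1.trace| ≤ ∑ i, |A.1 i i| := Finset.abs_sum_le_sum_abs _ _
    _ ≤ ∑ _i : Fin N, 1 := Finset.sum_le_sum fun i _ => A.abs_apply_le i i
    _ = N := by simp

variable (X : skewAdjoint (Matrix (Fin N) (Fin N) ℝ))

theorem matrixExp_mem_orthogonalGroup :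
    NormedSpace.exp X.1 ∈ Matrix.orthogonalGroup (Fin N) ℝ := by
  have hstar : star X.1 = -X.1 := skewAdjoint.mem_iff.mp X.2
  rw [Matrix.mem_orthogonalGroup_iff, ← Matrix.exp_transpose,
    ← Matrix.conjTranspose_eq_transpose_of_trivial, ← Matrix.star_eq_conjTranspose, hstar,
    ← Matrix.exp_add_of_commute _ _ (Commute.refl X.1).neg_right, add_neg_cancel,
    NormedSpace.exp_zero]

theorem det_matrixExp : (NormedSpace.exp X.1).det = 1 := by
  set Y := (2⁻¹ : ℝ) • X
  have hX : X.1 = Y.1 + Y.1 := congrArg Subtype.val (by module : X = Y + Y)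
  have hY := (Matrix.mem_orthogonalGroup_iff _ _).mp (matrixExp_mem_orthogonalGroup Y)
  rw [hX, Matrix.exp_add_of_commute _ _ (Commute.refl Y.1), Matrix.det_mul]
  simpa only [Matrix.det_mul, Matrix.det_transpose, Matrix.det_one] using congrArg Matrix.det hY

/-- The exponential map `𝔰𝔬(N) → SO(N)`, with `𝔰𝔬(N)` encoded as the skew-adjoint matrices. -/
noncomputable def exp : SO N :=
  ⟨NormedSpace.exp X.1, Matrix.mem_specialOrthogonalGroup_iff.mpr
    ⟨matrixExp_mem_orthogonalGroup X, det_matrixExp X⟩⟩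

theorem exp_zero : exp (0 : skewAdjoint (Matrix (Fin N) (Fin N) ℝ)) = 1 :=
  Subtype.ext NormedSpace.exp_zero

theorem exp_add_smul (s t : ℝ) : exp ((s + t) • X) = exp (s • X) * exp (t • X) := by
  have hcomm : Commute (s • X.1) (t • X.1) := ((Commute.refl X.1).smul_left s).smul_right t
  refine Subtype.ext ?_
  rw [exp, add_smul]
  exact Matrix.exp_add_of_commute _ _ hcomm

theorem inv_exp_smul (t : ℝ) : (exp (t • X))⁻¹ = exp (-t • X) := by
  rw [inv_eq_iff_mul_eq_one, ← exp_add_smul, add_neg_cancel, zero_smul, exp_zero]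

theorem hasDerivAt_exp_smul : HasDerivAt (fun t : ℝ => (exp (t • X)).1) X.1 0 := by
  have h := hasDerivAt_exp_smul_const X.1 (0 : ℝ)
  rw [zero_smul, NormedSpace.exp_zero, one_mul] at h
  exact h

theorem hasDerivAt_inv_exp_smul : HasDerivAt (fun t : ℝ => ((exp (t • X))⁻¹).1) (-X.1) 0 := by
  simp only [inv_exp_smul]
  have h := HasDerivAt.scomp_of_eq (0 : ℝ) (hasDerivAt_exp_smul X) (hasDerivAt_neg 0) neg_zero.symm
  rwa [neg_one_smul] at h

end SO

/-! ### Infinitesimal rotations -/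

section RotGen

variable (i j : Fin N) (P R : Matrix (Fin N) (Fin N) ℝ)

/-- The infinitesimal rotation in the coordinate plane `i, j`. As `i` and `j` vary, these run
twice, up to sign, through an orthogonal basis of `𝔰𝔬(N)`. -/
def rotGen : skewAdjoint (Matrix (Fin N) (Fin N) ℝ) :=
  ⟨Matrix.single i j 1 - Matrix.single j i 1, by
    simp [skewAdjoint.mem_iff, Matrix.star_eq_conjTranspose]⟩

theorem trace_rotGen_mul : ((rotGen i j).1 * P).trace = P j i - P i j := by
  simp [rotGen, sub_mul, Matrix.trace_sub, Matrix.trace_single_mul]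

theorem abs_trace_rotGen_mul_le (A : SO N) : |((rotGen i j).1 * A.1).trace| ≤ 2 :=
  calc |((rotGen i j).1 * A.1).trace| ≤ |A.1 j i| + |A.1 i j| := by
        rw [trace_rotGen_mul]
        exact abs_sub _ _
    _ ≤ 2 := by linarith [A.abs_apply_le j i, A.abs_apply_le i j]

theorem trace_rotGen_mul_rotGen_mul :
    ((rotGen i j).1 * P * (rotGen i j).1 * R).trace =
      P j i * R j i - P j j * R i i - P i i * R j j + P i j * R i j := by
  have trace_single (a b k l : Fin N) :
      (Matrix.single a b (1 : ℝ) * P * Matrix.single k l 1 * R).trace = P b k * R l a := by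
    rw [Matrix.single_mul_mul_single, Matrix.trace_single_mul]
    simp
  simp only [rotGen, sub_mul, mul_sub, Matrix.trace_sub, trace_single]
  ring

theorem sum_trace_rotGen_mul_rotGen_mul :
    ∑ i, ∑ j, ((rotGen i j).1 * P * (rotGen i j).1 * R).trace =
      2 * ((P.transpose * R).trace - P.trace * R.trace) := by
  have transpose_mul : (P.transpose * R).trace = ∑ i, ∑ j, P j i * R j i := by
    simp [Matrix.trace, Matrix.mul_apply]
  have transpose_mul' : (P.transpose * R).trace = ∑ i, ∑ j, P i j * R i j := by
    rw [transpose_mul, Finset.sum_comm]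
  have mul : P.trace * R.trace = ∑ i, ∑ j, P i i * R j j := by
    simp [Matrix.trace, Finset.sum_mul_sum]
  have mul' : P.trace * R.trace = ∑ i, ∑ j, P j j * R i i := by
    rw [mul, Finset.sum_comm]
  simp only [trace_rotGen_mul_rotGen_mul, Finset.sum_add_distrib, Finset.sum_sub_distrib]
  linarith

theorem sum_trace_rotGen_mul_mul_trace_rotGen_mul :
    ∑ i, ∑ j, ((rotGen i j).1 * P).trace * ((rotGen i j).1 * R).trace =
      2 * ((P * R.transpose).trace - (P * R).trace) := by
  have mul_transpose : (P * R.transpose).trace = ∑ i, ∑ j, P i j * R i j := by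
    simp [Matrix.trace, Matrix.mul_apply]
  have mul_transpose' : (P * R.transpose).trace = ∑ i, ∑ j, P j i * R j i := by
    rw [mul_transpose, Finset.sum_comm]
  have mul : (P * R).trace = ∑ i, ∑ j, P i j * R j i := by
    simp [Matrix.trace, Matrix.mul_apply]
  have mul' : (P * R).trace = ∑ i, ∑ j, P j i * R i j := by
    rw [mul, Finset.sum_comm]
  simp only [trace_rotGen_mul, sub_mul, mul_sub, Finset.sum_sub_distrib]
  linarith

end RotGen

/-! ### The action of `SO(N)` on one edge variable -/

/-- Left multiplication by `g` of the variable `Q_e`, hence right multiplication by `g⁻¹` of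
`Q_{e⁻¹}`. -/
noncomputable def act (e : Edge d) (g : SO N) (Q : Config Λ N) : Config Λ N :=
  (fun f : PosEdgeIn Λ => if f.1 = e then g else 1) * Q *
    (fun f : PosEdgeIn Λ => if f.1 = e.inv then g⁻¹ else 1)

theorem act_one (e : Edge d) (Q : Config Λ N) : act e 1 Q = Q := by
  funext f; simp [act]

theorem act_mul (e : Edge d) (g h : SO N) (Q : Config Λ N) :
    act e (g * h) Q = act e g (act e h Q) := by
  funext f
  simp only [act, Pi.mul_apply]
  split_ifs <;> simp [mul_assoc]

@[fun_prop]
theorem continuous_act (e : Edge d) (g : SO N) :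
    Continuous (act e g : Config Λ N → Config Λ N) := by
  unfold act
  fun_prop

theorem integral_act {E : Type*} [NormedAddCommGroup E] [NormedSpace ℝ E] (e : Edge d) (g : SO N)
    (F : Config Λ N → E) : ∫ Q, F (act e g Q) ∂(haarConfig Λ N) = ∫ Q, F Q ∂(haarConfig Λ N) := by
  unfold act
  rw [integral_mul_left_eq_self (μ := haarConfig Λ N) (fun Q : Config Λ N => F (Q * _)),
    integral_mul_right_eq_self (μ := haarConfig Λ N)]

theorem edgeVar_act_self {e : Edge d} (hsrc : e.src ∈ Λ) (htgt : e.tgt ∈ Λ) (g : SO N)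
    (Q : Config Λ N) : edgeVar (act e g Q) e = g * edgeVar Q e := by
  have hinv := e.isPos_inv_iff
  unfold edgeVar
  by_cases hpos : e.IsPos
  · simp [hpos, hsrc, htgt, act, e.ne_inv]
  · simp [hpos, hinv.mpr hpos, hsrc, htgt, act, e.ne_inv.symm]

theorem edgeVar_act_of_ne {e f : Edge d} (hne : f ≠ e) (hne_inv : f ≠ e.inv) (g : SO N)
    (Q : Config Λ N) : edgeVar (act e g Q) f = edgeVar Q f := by
  have inv_ne : f.inv ≠ e := fun h => hne_inv (by rw [← h, Edge.inv_inv])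
  have inv_ne_inv : f.inv ≠ e.inv := fun h => hne (Edge.inv_injective h)
  unfold edgeVar
  simp only [act, Pi.mul_apply, hne, hne_inv, inv_ne, inv_ne_inv, if_false, one_mul, mul_one]

theorem edgeVar_inv_act {e : Edge d} (hsrc : e.src ∈ Λ) (htgt : e.tgt ∈ Λ) (g : SO N)
    (Q : Config Λ N) : edgeVar (act e g Q) e.inv = edgeVar Q e.inv * g⁻¹ := by
  rw [edgeVar_inv, edgeVar_act_self hsrc htgt, edgeVar_inv, mul_inv_rev]

@[fun_prop]
theorem continuous_edgeVar (f : Edge d) : Continuous fun Q : Config Λ N => edgeVar Q f := by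
  unfold edgeVar
  split_ifs <;> fun_prop

@[fun_prop]
theorem continuous_hol (ρ : List (Edge d)) : Continuous fun Q : Config Λ N => (hol Q ρ).1 := by
  refine continuous_subtype_val.comp ?_
  induction ρ with
  | nil => exact continuous_const
  | cons f t ih =>
    simp only [hol_cons]
    fun_prop

@[fun_prop]
theorem continuous_pathTrace (ρ : List (Edge d)) :
    Continuous fun Q : Config Λ N => pathTrace Q ρ :=
  (continuous_hol ρ).matrix_trace

/-! ### Lie derivatives -/

section HasLieDeriv

variable {E : Type*} [NormedAddCommGroup E] [NormedSpace ℝ E] {e : Edge d}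
  {X : skewAdjoint (Matrix (Fin N) (Fin N) ℝ)}

/-- `F'` is the derivative of `F` along the flow that multiplies the variable of the edge `e` by the
one-parameter subgroup generated by `X`. -/
def HasLieDeriv (e : Edge d) (X : skewAdjoint (Matrix (Fin N) (Fin N) ℝ))
    (F F' : Config Λ N → E) : Prop :=
  ∀ Q, HasDerivAt (fun t : ℝ => F (act e (SO.exp (t • X)) Q)) (F' Q) 0

theorem act_exp_zero_smul (e : Edge d) (X : skewAdjoint (Matrix (Fin N) (Fin N) ℝ))
    (Q : Config Λ N) : act e (SO.exp ((0 : ℝ) • X)) Q = Q := by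
  rw [zero_smul, SO.exp_zero, act_one]

namespace HasLieDeriv

theorem mul {A : Type*} [NormedRing A] [NormedAlgebra ℝ A] {F F' G G' : Config Λ N → A}
    (hF : HasLieDeriv e X F F') (hG : HasLieDeriv e X G G') :
    HasLieDeriv e X (fun Q => F Q * G Q) (fun Q => F' Q * G Q + F Q * G' Q) := by
  intro Q
  have h := (hF Q).fun_mul (hG Q)
  rwa [act_exp_zero_smul] at h

theorem exp {F F' : Config Λ N → ℝ} (hF : HasLieDeriv e X F F') :
    HasLieDeriv e X (fun Q => Real.exp (F Q)) (fun Q => Real.exp (F Q) * F' Q) := by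
  intro Q
  have h := (hF Q).exp
  rwa [act_exp_zero_smul] at h

theorem hasDerivAt {F F' : Config Λ N → E} (hF : HasLieDeriv e X F F') (Q : Config Λ N) (t : ℝ) :
    HasDerivAt (fun s : ℝ => F (act e (SO.exp (s • X)) Q))
      (F' (act e (SO.exp (t • X)) Q)) t := by
  have flow (s : ℝ) : act e (SO.exp (s • X)) Q =
      act e (SO.exp ((s - t) • X)) (act e (SO.exp (t • X)) Q) := by
    rw [← act_mul, ← SO.exp_add_smul, sub_add_cancel]
  have h := hF (act e (SO.exp (t • X)) Q)
  rw [← sub_self t] at h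
  refine (h.comp_sub_const t t).congr_of_eventuallyEq (Eventually.of_forall fun s => ?_)
  simp only [flow s]

theorem integral_eq_zero {F F' : Config Λ N → E} (h : HasLieDeriv e X F F') (hF : Continuous F)
    (hF' : Continuous F') : ∫ Q, F' Q ∂(haarConfig Λ N) = 0 := by
  obtain ⟨C, hC⟩ := isCompact_univ.exists_bound_of_continuousOn hF'.continuousOn
  have integrable_act {G : Config Λ N → E} (hG : Continuous G) (t : ℝ) :
      Integrable (fun Q => G (act e (SO.exp (t • X)) Q)) (haarConfig Λ N) :=
    integrable_of_continuous (by fun_prop)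
  have deriv_integral := (hasDerivAt_integral_of_dominated_loc_of_deriv_le
    (x₀ := (0 : ℝ)) (bound := fun _ => C) univ_mem
    (Eventually.of_forall fun t => (integrable_act hF t).aestronglyMeasurable)
    (integrable_act hF 0) (integrable_act hF' 0).aestronglyMeasurable
    (Eventually.of_forall fun Q t _ => hC _ trivial) (integrable_const C)
    (Eventually.of_forall fun Q t _ => h.hasDerivAt Q t)).2
  simp only [integral_act] at deriv_integral
  exact deriv_integral.unique (hasDerivAt_const _ _)

end HasLieDeriv

end HasLieDeriv

/-- The derivative of the holonomy of a path when the variable of `e` moves in the direction `X`: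
an occurrence of `e` gets `X` inserted before it, one of `e⁻¹` gets `-X` inserted after it. -/
noncomputable def holDeriv (e : Edge d) (X : Matrix (Fin N) (Fin N) ℝ) (Q : Config Λ N)
    (ρ : List (Edge d)) : Matrix (Fin N) (Fin N) ℝ :=
  ∑ y ∈ locs ρ e, (hol Q (before ρ y)).1 * X * (hol Q (e :: after ρ y)).1 -
    ∑ y ∈ locs ρ e.inv, (hol Q (before ρ y ++ [e.inv])).1 * X * (hol Q (after ρ y)).1

@[fun_prop]
theorem continuous_holDeriv (e : Edge d) (X : Matrix (Fin N) (Fin N) ℝ) (ρ : List (Edge d)) :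
    Continuous fun Q : Config Λ N => holDeriv e X Q ρ := by
  unfold holDeriv
  fun_prop

@[simp] theorem holDeriv_nil (e : Edge d) (X : Matrix (Fin N) (Fin N) ℝ) (Q : Config Λ N) :
    holDeriv e X Q [] = 0 := by simp [holDeriv, locs]

theorem holDeriv_singleton (e : Edge d) (X : Matrix (Fin N) (Fin N) ℝ) (Q : Config Λ N)
    (f : Edge d) :
    holDeriv e X Q [f] =
      (if f = e then X * (edgeVar Q e).1 else 0) -
        if f = e.inv then (edgeVar Q e.inv).1 * X else 0 := by
  simp [holDeriv, sum_locs_singleton, before, after]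

theorem holDeriv_cons (e : Edge d) (X : Matrix (Fin N) (Fin N) ℝ) (Q : Config Λ N) (f : Edge d)
    (ρ : List (Edge d)) :
    holDeriv e X Q (f :: ρ) =
      holDeriv e X Q [f] * (hol Q ρ).1 + (edgeVar Q f).1 * holDeriv e X Q ρ := by
  have hol_val_cons (g : Edge d) (w : List (Edge d)) :
      (hol Q (g :: w)).1 = (edgeVar Q g).1 * (hol Q w).1 := by rw [hol_cons]; rfl
  rw [holDeriv_singleton]
  simp only [holDeriv, sum_locs_cons, before, after, Nat.add_comm 1, List.take_succ_cons,
    List.drop_succ_cons, List.cons_append, hol_val_cons, mul_sub, Finset.mul_sum, mul_assoc]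
  simp only [sub_mul, ite_mul, zero_mul, mul_assoc, List.take_zero, List.drop_zero, List.nil_append,
    hol_nil, hol_cons, hol_append, OneMemClass.coe_one, Submonoid.coe_mul, one_mul, mul_one]
  abel

section

open scoped Matrix.Norms.L2Operator

variable {e : Edge d} (hsrc : e.src ∈ Λ) (htgt : e.tgt ∈ Λ)
  (X : skewAdjoint (Matrix (Fin N) (Fin N) ℝ))

include hsrc htgt

theorem hasLieDeriv_edgeVar (f : Edge d) :
    HasLieDeriv e X (fun Q : Config Λ N => (edgeVar Q f).1) fun Q => holDeriv e X.1 Q [f] := by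
  intro Q
  simp only [holDeriv_singleton]
  by_cases hf : f = e
  · subst hf
    simp only [edgeVar_act_self hsrc htgt, if_true, f.ne_inv, if_false, sub_zero]
    exact (SO.hasDerivAt_exp_smul X).mul_const (edgeVar Q f).1
  by_cases hf' : f = e.inv
  · subst hf'
    simp only [edgeVar_inv_act hsrc htgt, if_true, e.ne_inv.symm, if_false, zero_sub, ← mul_neg]
    exact (SO.hasDerivAt_inv_exp_smul X).const_mul (edgeVar Q e.inv).1
  · simp only [edgeVar_act_of_ne hf hf', hf, hf', if_false, sub_zero]
    exact hasDerivAt_const _ _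

theorem hasLieDeriv_hol (ρ : List (Edge d)) :
    HasLieDeriv e X (fun Q : Config Λ N => (hol Q ρ).1) fun Q => holDeriv e X.1 Q ρ := by
  induction ρ with
  | nil => exact fun Q => by simpa using hasDerivAt_const _ _
  | cons f ρ ih =>
    simp only [hol_cons, holDeriv_cons _ _ _ f ρ]
    exact (hasLieDeriv_edgeVar hsrc htgt X f).mul ih

theorem hasLieDeriv_trace_mul_hol (A : Matrix (Fin N) (Fin N) ℝ) (ρ : List (Edge d)) :
    HasLieDeriv e X (fun Q : Config Λ N => (A * (hol Q ρ).1).trace)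
      fun Q => (A * holDeriv e X.1 Q ρ).trace := fun Q =>
  (Matrix.traceLinearMap (Fin N) ℝ ℝ).toContinuousLinearMap.hasFDerivAt.comp_hasDerivAt _
    ((hasLieDeriv_hol hsrc htgt X ρ Q).const_mul A)

theorem hasLieDeriv_pathTrace (ρ : List (Edge d)) :
    HasLieDeriv e X (fun Q : Config Λ N => pathTrace Q ρ)
      fun Q => (holDeriv e X.1 Q ρ).trace := by
  simpa only [one_mul, pathTrace_eq] using hasLieDeriv_trace_mul_hol hsrc htgt X 1 ρ

end

/-! ### The Schwinger–Dyson equation -/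

/-- The logarithm `Nβ ∑_p W_p` of the unnormalized density of the gauge measure. -/
noncomputable def action (β : ℝ) (Q : Config Λ N) : ℝ :=
  N * β * ∑ p ∈ plaquettesIn Λ, pathTrace Q p

@[fun_prop]
theorem continuous_action (β : ℝ) : Continuous (action β : Config Λ N → ℝ) := by
  unfold action
  fun_prop

instance (β : ℝ) : IsProbabilityMeasure (gaugeMeasure Λ N β) :=
  isProbabilityMeasure_tilted (μ := haarConfig Λ N) (f := action β)
    (integrable_of_continuous (by fun_prop))

section IntegrationByParts

variable {e : Edge d} (hsrc : e.src ∈ Λ) (htgt : e.tgt ∈ Λ)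
  {X : skewAdjoint (Matrix (Fin N) (Fin N) ℝ)}

include hsrc htgt

theorem hasLieDeriv_action (X : skewAdjoint (Matrix (Fin N) (Fin N) ℝ)) (β : ℝ) :
    HasLieDeriv e X (action β : Config Λ N → ℝ)
      fun Q => N * β * ∑ p ∈ plaquettesIn Λ, (holDeriv e X.1 Q p).trace := fun Q =>
  (HasDerivAt.fun_sum fun p _ => hasLieDeriv_pathTrace hsrc htgt X p Q).const_mul _

theorem HasLieDeriv.integral_gaugeMeasure_eq_zero {F F' : Config Λ N → ℝ}
    (h : HasLieDeriv e X F F') (hF : Continuous F) (hF' : Continuous F') (β : ℝ) :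
    ∫ Q, (F' Q + F Q * (N * β * ∑ p ∈ plaquettesIn Λ, (holDeriv e X.1 Q p).trace))
      ∂(gaugeMeasure Λ N β) = 0 := by
  have weighted := (h.mul (hasLieDeriv_action hsrc htgt X β).exp).integral_eq_zero
    (by fun_prop) (by fun_prop)
  change ∫ Q, _ ∂((haarConfig Λ N).tilted (action β)) = 0
  rw [integral_tilted, ← zero_div (∫ Q, Real.exp (action β Q) ∂(haarConfig Λ N)), ← weighted,
    ← integral_div]
  refine integral_congr_ae (Eventually.of_forall fun Q => ?_)
  simp only [smul_eq_mul]
  ring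

end IntegrationByParts

section Plaquette

variable (e : Edge d) (X : skewAdjoint (Matrix (Fin N) (Fin N) ℝ)) (Q : Config Λ N)

theorem trace_skewAdjoint_mul_inv (A : SO N) : (X.1 * (A⁻¹).1).trace = -(X.1 * A.1).trace := by
  have hX : X.1.transpose = -X.1 := by
    rw [← Matrix.conjTranspose_eq_transpose_of_trivial, ← Matrix.star_eq_conjTranspose]
    exact skewAdjoint.mem_iff.mp X.2
  rw [SO.coe_inv_eq_transpose, ← Matrix.trace_transpose, Matrix.transpose_mul,
    Matrix.transpose_transpose, hX, mul_neg, Matrix.trace_neg, Matrix.trace_mul_comm]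

theorem trace_holDeriv (ρ : List (Edge d)) :
    (holDeriv e X.1 Q ρ).trace =
      ∑ y ∈ locs ρ e, (X.1 * (hol Q (e :: (after ρ y ++ before ρ y))).1).trace +
        ∑ y ∈ locs ρ e.inv,
          (X.1 * (hol Q (e :: (invPath (before ρ y) ++ invPath (after ρ y)))).1).trace := by
  have cyclic (A B : SO N) : (A.1 * X.1 * B.1).trace = (X.1 * (B * A).1).trace := by
    rw [mul_assoc, Matrix.trace_mul_comm, mul_assoc]
    rfl
  have reverse (y : ℕ) : hol Q (after ρ y) * hol Q (before ρ y ++ [e.inv]) =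
      (hol Q (e :: (invPath (before ρ y) ++ invPath (after ρ y))))⁻¹ := by
    simp [edgeVar_inv, mul_assoc]
  simp only [holDeriv, Matrix.trace_sub, Matrix.trace_sum, cyclic, reverse,
    trace_skewAdjoint_mul_inv, Finset.sum_neg_distrib, sub_neg_eq_add, ← hol_append,
    List.cons_append]

variable {e} in
theorem trace_holDeriv_plaquette {p : List (Edge d)} (hp : p ∈ plaquettesAt e) :
    (holDeriv e X.1 Q p).trace = (X.1 * (hol Q (e :: staple e p)).1).trace := by
  obtain ⟨hpos, he⟩ := mem_plaquettesAt.mp hp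
  rw [trace_holDeriv, staple]
  split_ifs with h
  · rw [locs_eq_singleton hpos.pairwise h, locs_inv_eq_empty hpos.pairwise h,
      Finset.sum_singleton, Finset.sum_empty, add_zero]
  · have h' := (getElem?_locIn he).resolve_left h
    have h_empty := locs_inv_eq_empty hpos.pairwise h'
    rw [Edge.inv_inv] at h_empty
    rw [locs_eq_singleton hpos.pairwise h', h_empty, Finset.sum_singleton, Finset.sum_empty,
      zero_add]

variable {e} in
theorem sum_trace_holDeriv_plaquette (hΛ : plaquettesAt e ⊆ plaquettesIn Λ) :
    ∑ p ∈ plaquettesIn Λ, (holDeriv e X.1 Q p).trace =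
      ∑ p ∈ plaquettesAt e, (X.1 * (hol Q (e :: staple e p)).1).trace := by
  rw [← Finset.sum_subset hΛ fun p hp hpe => ?_]
  · exact Finset.sum_congr rfl fun p hp => trace_holDeriv_plaquette X Q hp
  · have he : ¬(e ∈ p ∨ e.inv ∈ p) := fun he =>
      hpe (mem_plaquettesAt.mpr ⟨(mem_plaquettesIn.mp hp).1, he⟩)
    rw [trace_holDeriv, locs_eq_empty (not_or.mp he).1, locs_eq_empty (not_or.mp he).2]
    simp

end Plaquette

/-- The normalized trace `W_ρ / N` of the holonomy of a path. -/
noncomputable def normTrace (Q : Config Λ N) (ρ : List (Edge d)) : ℝ := pathTrace Q ρ / N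

theorem abs_normTrace_le_one (Q : Config Λ N) (ρ : List (Edge d)) : |normTrace Q ρ| ≤ 1 := by
  rw [normTrace, abs_div, Nat.abs_cast]
  exact div_le_one_of_le₀ (SO.abs_trace_le _) (Nat.cast_nonneg _)

@[fun_prop]
theorem continuous_normTrace (ρ : List (Edge d)) :
    Continuous fun Q : Config Λ N => normTrace Q ρ :=
  (continuous_pathTrace ρ).div_const _

/-- The product of the normalized traces of a sequence of paths. -/
noncomputable def normProd (Q : Config Λ N) (ps : List (List (Edge d))) : ℝ :=
  (ps.map (normTrace Q)).prod

theorem normProd_cons (Q : Config Λ N) (p : List (Edge d)) (ps : List (List (Edge d))) :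
    normProd Q (p :: ps) = normTrace Q p * normProd Q ps := by simp [normProd]

theorem abs_normProd_le_one (Q : Config Λ N) (ps : List (List (Edge d))) :
    |normProd Q ps| ≤ 1 := by
  induction ps with
  | nil => simp [normProd]
  | cons p ps ih =>
    rw [normProd_cons, abs_mul]
    exact mul_le_one₀ (abs_normTrace_le_one Q p) (abs_nonneg _) ih

@[fun_prop]
theorem continuous_normProd (ps : List (List (Edge d))) :
    Continuous fun Q : Config Λ N => normProd Q ps := by
  induction ps with
  | nil => exact continuous_const
  | cons p ps ih =>
    simp only [normProd_cons]
    fun_prop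

theorem abs_sum_locs_le {c : ℝ} (hc : 0 ≤ c) (ρ : List (Edge d)) (e : Edge d) {G : ℕ → ℝ}
    (hG : ∀ y, |G y| ≤ c) : |∑ y ∈ locs ρ e, G y| ≤ ρ.length * c :=
  calc |∑ y ∈ locs ρ e, G y| ≤ ∑ y ∈ locs ρ e, |G y| := Finset.abs_sum_le_sum_abs _ _
    _ ≤ (locs ρ e).card * c := by
      simpa only [nsmul_eq_mul] using Finset.sum_le_card_nsmul _ _ c fun y _ => hG y
    _ ≤ ρ.length * c := by gcongr; exact card_locs_le ρ e

theorem abs_trace_holDeriv_rotGen_le (e : Edge d) (i j : Fin N) (Q : Config Λ N)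
    (ρ : List (Edge d)) : |(holDeriv e (rotGen i j).1 Q ρ).trace| ≤ 4 * ρ.length := by
  have forward := abs_sum_locs_le zero_le_two ρ e fun y =>
    abs_trace_rotGen_mul_le i j (hol Q (e :: (after ρ y ++ before ρ y)))
  have backward := abs_sum_locs_le zero_le_two ρ e.inv fun y =>
    abs_trace_rotGen_mul_le i j (hol Q (e :: (invPath (before ρ y) ++ invPath (after ρ y))))
  rw [trace_holDeriv]
  exact (abs_add_le _ _).trans (by linarith)

theorem exists_hasLieDeriv_normProd {e : Edge d} (hsrc : e.src ∈ Λ) (htgt : e.tgt ∈ Λ)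
    (i j : Fin N) (ps : List (List (Edge d))) :
    ∃ D : Config Λ N → ℝ, HasLieDeriv e (rotGen i j) (fun Q => normProd Q ps) D ∧ Continuous D ∧
      ∀ Q, |D Q| ≤ 4 * (ps.map List.length).sum / N := by
  induction ps with
  | nil => exact ⟨0, fun _ => hasDerivAt_const _ _, continuous_const, fun Q => by simp⟩
  | cons p ps ih =>
    obtain ⟨D, hD, hD_cont, hD_le⟩ := ih
    have hp : HasLieDeriv e (rotGen i j) (fun Q : Config Λ N => normTrace Q p) fun Q =>
        (holDeriv e (rotGen i j).1 Q p).trace / N := fun Q =>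
      (hasLieDeriv_pathTrace hsrc htgt (rotGen i j) p Q).div_const _
    refine ⟨_, by simpa only [normProd_cons] using hp.mul hD, by fun_prop, fun Q => ?_⟩
    have hp_le : |(holDeriv e (rotGen i j).1 Q p).trace / N| ≤ 4 * p.length / N := by
      rw [abs_div, Nat.abs_cast]
      gcongr
      exact abs_trace_holDeriv_rotGen_le e i j Q p
    calc _ ≤ |(holDeriv e (rotGen i j).1 Q p).trace / N| * |normProd Q ps| +
          |normTrace Q p| * |D Q| := (abs_add_le _ _).trans_eq (by rw [abs_mul, abs_mul])
      _ ≤ 4 * p.length / N * 1 + 1 * (4 * (ps.map List.length).sum / N) := by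
        gcongr
        exacts [abs_normProd_le_one Q ps, abs_normTrace_le_one Q p, hD_le Q]
      _ = 4 * ((p :: ps).map List.length).sum / N := by
        rw [List.map_cons, List.sum_cons]
        push_cast
        ring

/-- The right-hand side minus the left-hand side of the master loop equation at the first location
of the word `eτ`, before integration and up to errors of order `1 / N`. -/
noncomputable def sdTerm (β : ℝ) (Q : Config Λ N) (e : Edge d) (τ : List (Edge d)) : ℝ :=
  ∑ y ∈ locs τ e.inv, normTrace Q (before τ y) * normTrace Q (after τ y)
    - ∑ y ∈ locs τ e, normTrace Q (e :: before τ y) * normTrace Q (e :: after τ y)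
    + β * ∑ p ∈ plaquettesAt e,
        (normTrace Q (τ ++ invPath (staple e p)) - normTrace Q (e :: τ ++ e :: staple e p))
    - normTrace Q (e :: τ)

@[fun_prop]
theorem continuous_sdTerm (β : ℝ) (e : Edge d) (τ : List (Edge d)) :
    Continuous fun Q : Config Λ N => sdTerm β Q e τ := by
  unfold sdTerm
  fun_prop

theorem abs_sum_trace_rotGen_mul_rotGen_mul_add_le (A B : SO N) :
    |(∑ i, ∑ j, ((rotGen i j).1 * A.1 * (rotGen i j).1 * B.1).trace) +
      2 * (A.1.trace * B.1.trace)| ≤ 2 * N := by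
  have h : (A.1.transpose * B.1).trace = (A⁻¹ * B : SO N).1.trace := by
    rw [← SO.coe_inv_eq_transpose]; rfl
  rw [sum_trace_rotGen_mul_rotGen_mul, h, mul_sub, sub_add_cancel, abs_mul, abs_two]
  gcongr
  exact SO.abs_trace_le _

theorem sum_trace_rotGen_mul_hol_mul_trace (Q : Config Λ N) (ρ ρ' : List (Edge d)) :
    ∑ i, ∑ j, ((rotGen i j).1 * (hol Q ρ).1).trace * ((rotGen i j).1 * (hol Q ρ').1).trace =
      2 * (pathTrace Q (ρ ++ invPath ρ') - pathTrace Q (ρ ++ ρ')) := by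
  rw [sum_trace_rotGen_mul_mul_trace_rotGen_mul, ← SO.coe_inv_eq_transpose, pathTrace_eq,
    pathTrace_eq, hol_append, hol_append, hol_invPath]
  rfl

theorem abs_sum_trace_rotGen_mul_holDeriv_add_le (e : Edge d) (Q : Config Λ N)
    (ρ : List (Edge d)) :
    |(∑ i, ∑ j, ((rotGen i j).1 * holDeriv e (rotGen i j).1 Q ρ).trace) +
      2 * (∑ y ∈ locs ρ e, pathTrace Q (before ρ y) * pathTrace Q (e :: after ρ y) -
        ∑ y ∈ locs ρ e.inv, pathTrace Q (before ρ y ++ [e.inv]) * pathTrace Q (after ρ y))| ≤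
      4 * N * ρ.length := by
  set S : SO N → SO N → ℝ := fun A B =>
    (∑ i, ∑ j, ((rotGen i j).1 * A.1 * (rotGen i j).1 * B.1).trace) +
      2 * (A.1.trace * B.1.trace) with hS
  have S_le (A B : SO N) : |S A B| ≤ 2 * N := abs_sum_trace_rotGen_mul_rotGen_mul_add_le A B
  have forward := abs_sum_locs_le (by positivity) ρ e fun y =>
    S_le (hol Q (before ρ y)) (hol Q (e :: after ρ y))
  have backward := abs_sum_locs_le (by positivity) ρ e.inv fun y =>
    S_le (hol Q (before ρ y ++ [e.inv])) (hol Q (after ρ y))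
  calc _ = |(∑ y ∈ locs ρ e, S (hol Q (before ρ y)) (hol Q (e :: after ρ y))) -
        ∑ y ∈ locs ρ e.inv, S (hol Q (before ρ y ++ [e.inv])) (hol Q (after ρ y))| := by
        congr 1
        simp only [hS, holDeriv, mul_sub, Matrix.trace_sub, Finset.sum_sub_distrib, Finset.mul_sum,
          Matrix.trace_sum, Finset.sum_add_distrib, pathTrace_eq, ← mul_assoc]
        simp only [Finset.sum_comm (t := locs ρ _)]
        ring
    _ ≤ 4 * N * ρ.length := (abs_sub _ _).trans (by linarith)

theorem sum_locs_cons_pathTrace (e : Edge d) (Q : Config Λ N) (τ : List (Edge d)) :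
    ∑ y ∈ locs (e :: τ) e, pathTrace Q (before (e :: τ) y) * pathTrace Q (e :: after (e :: τ) y) -
      ∑ y ∈ locs (e :: τ) e.inv,
        pathTrace Q (before (e :: τ) y ++ [e.inv]) * pathTrace Q (after (e :: τ) y) =
    N * pathTrace Q (e :: τ) +
      ∑ y ∈ locs τ e, pathTrace Q (e :: before τ y) * pathTrace Q (e :: after τ y) -
      ∑ y ∈ locs τ e.inv, pathTrace Q (before τ y) * pathTrace Q (after τ y) := by
  have cancel (ρ : List (Edge d)) : pathTrace Q (e :: (ρ ++ [e.inv])) = pathTrace Q ρ := by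
    rw [← List.cons_append, pathTrace_append_comm]
    simp [pathTrace_eq, edgeVar_inv]
  simp only [sum_locs_cons, if_true, e.ne_inv, if_false, zero_add, before, after,
    Nat.add_comm 1, List.take_succ_cons, List.drop_succ_cons, List.take_zero, List.drop_zero,
    List.cons_append, cancel, pathTrace_nil]

/-- The sum over the infinitesimal rotations `X` of the derivative of `Tr(X Q_e Q_τ)` with respect
to the gauge measure: the derivative of its product with the density, divided by the density. -/
noncomputable def ibpTerm (β : ℝ) (Q : Config Λ N) (e : Edge d) (τ : List (Edge d)) : ℝ :=
  ∑ i, ∑ j, (((rotGen i j).1 * holDeriv e (rotGen i j).1 Q (e :: τ)).trace +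
    ((rotGen i j).1 * (hol Q (e :: τ)).1).trace *
      (N * β * ∑ p ∈ plaquettesAt e, ((rotGen i j).1 * (hol Q (e :: staple e p)).1).trace))

@[fun_prop]
theorem continuous_ibpTerm (β : ℝ) (e : Edge d) (τ : List (Edge d)) :
    Continuous fun Q : Config Λ N => ibpTerm β Q e τ := by
  unfold ibpTerm
  fun_prop

theorem abs_ibpTerm_sub_sdTerm_le (hN : 0 < N) (β : ℝ) (Q : Config Λ N) (e : Edge d)
    (τ : List (Edge d)) :
    |ibpTerm β Q e τ - 2 * N ^ 2 * sdTerm β Q e τ| ≤ 4 * (N : ℝ) * (τ.length + 1) := by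
  have cancel (ρ : List (Edge d)) :
      pathTrace Q (e :: τ ++ invPath (e :: ρ)) = pathTrace Q (τ ++ invPath ρ) := by
    rw [invPath_cons, ← List.append_assoc, pathTrace_append_comm]
    simp [pathTrace_eq, edgeVar_inv]
  have plaquette_terms : ∑ i, ∑ j, ((rotGen i j).1 * (hol Q (e :: τ)).1).trace *
      (N * β * ∑ p ∈ plaquettesAt e, ((rotGen i j).1 * (hol Q (e :: staple e p)).1).trace) =
      N * β * ∑ p ∈ plaquettesAt e, 2 * (pathTrace Q (τ ++ invPath (staple e p)) -
        pathTrace Q (e :: τ ++ e :: staple e p)) := by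
    simp only [← cancel, ← sum_trace_rotGen_mul_hol_mul_trace]
    simp only [Finset.mul_sum, Finset.sum_comm (s := plaquettesAt e)]
    exact Finset.sum_congr rfl fun i _ => Finset.sum_congr rfl fun j _ =>
      Finset.sum_congr rfl fun p _ => by ring
  have splitting_terms := abs_sum_trace_rotGen_mul_holDeriv_add_le e Q (e :: τ)
  rw [sum_locs_cons_pathTrace, List.length_cons, Nat.cast_add_one] at splitting_terms
  refine le_of_eq_of_le (congrArg abs ?_) splitting_terms
  simp only [ibpTerm, Finset.sum_add_distrib, plaquette_terms, sdTerm, normTrace]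
  simp only [div_mul_div_comm, ← sub_div, ← Finset.sum_div, ← Finset.mul_sum]
  field_simp
  ring

section SchwingerDyson

variable {e : Edge d} (hsrc : e.src ∈ Λ) (htgt : e.tgt ∈ Λ)
  (hΛ : plaquettesAt e ⊆ plaquettesIn Λ) (β : ℝ) (τ : List (Edge d)) (ps : List (List (Edge d)))

include hsrc htgt hΛ

theorem exists_integral_ibpTerm_mul_normProd_add_eq_zero :
    ∃ J : Config Λ N → ℝ, Continuous J ∧ (∀ Q, |J Q| ≤ 8 * N * (ps.map List.length).sum) ∧
      ∫ Q, (ibpTerm β Q e τ * normProd Q ps + J Q) ∂(gaugeMeasure Λ N β) = 0 := by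
  choose D hD hD_cont hD_le using fun i j : Fin N => exists_hasLieDeriv_normProd hsrc htgt i j ps
  refine ⟨fun Q => ∑ i, ∑ j, ((rotGen i j).1 * (hol Q (e :: τ)).1).trace * D i j Q, by fun_prop,
    fun Q => ?_, ?_⟩
  · calc _ ≤ ∑ i, ∑ j, |((rotGen i j).1 * (hol Q (e :: τ)).1).trace * D i j Q| :=
          (Finset.abs_sum_le_sum_abs _ _).trans
            (Finset.sum_le_sum fun i _ => Finset.abs_sum_le_sum_abs _ _)
      _ ≤ ∑ _i : Fin N, ∑ _j : Fin N, 2 * (4 * (ps.map List.length).sum / N : ℝ) := by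
        gcongr with i _ j _
        rw [abs_mul]
        gcongr
        exacts [abs_trace_rotGen_mul_le i j _, hD_le i j Q]
      _ = 8 * N * (ps.map List.length).sum := by
        simp only [Finset.sum_const, Finset.card_univ, Fintype.card_fin, nsmul_eq_mul]
        field
  · have by_parts (i j : Fin N) := ((hasLieDeriv_trace_mul_hol hsrc htgt (rotGen i j)
      (rotGen i j).1 (e :: τ)).mul (hD i j)).integral_gaugeMeasure_eq_zero hsrc htgt
      (by fun_prop) (by fun_prop) β
    simp only [sum_trace_holDeriv_plaquette _ _ hΛ] at by_parts
    simp only [ibpTerm, Finset.sum_mul, ← Finset.sum_add_distrib]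
    rw [integral_finsetSum _ fun i _ => integrable_of_continuous (by fun_prop)]
    refine Finset.sum_eq_zero fun i _ => ?_
    rw [integral_finsetSum _ fun j _ => integrable_of_continuous (by fun_prop)]
    refine Finset.sum_eq_zero fun j _ => (integral_congr_ae ?_).trans (by_parts i j)
    exact Eventually.of_forall fun Q => by ring

theorem abs_integral_sdTerm_mul_normProd_le (hN : 0 < N) :
    |∫ Q, sdTerm β Q e τ * normProd Q ps ∂(gaugeMeasure Λ N β)| ≤
      (2 * (τ.length + 1) + 4 * (ps.map List.length).sum) / N := by
  have hN' : (0 : ℝ) < N := Nat.cast_pos.mpr hN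
  obtain ⟨J, J_cont, J_le, integral_eq_zero⟩ :=
    exists_integral_ibpTerm_mul_normProd_add_eq_zero (N := N) hsrc htgt hΛ β τ ps
  have error_le (Q : Config Λ N) :
      ‖ibpTerm β Q e τ * normProd Q ps + J Q - 2 * N ^ 2 * (sdTerm β Q e τ * normProd Q ps)‖ ≤
        2 * N * (2 * (τ.length + 1) + 4 * (ps.map List.length).sum) :=
    calc _ = |(ibpTerm β Q e τ - 2 * N ^ 2 * sdTerm β Q e τ) * normProd Q ps + J Q| := by
          rw [Real.norm_eq_abs]; ring_nf
      _ ≤ |ibpTerm β Q e τ - 2 * N ^ 2 * sdTerm β Q e τ| * |normProd Q ps| + |J Q| :=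
        (abs_add_le _ _).trans_eq (by rw [abs_mul])
      _ ≤ 4 * N * (τ.length + 1) * 1 + 8 * N * (ps.map List.length).sum := by
        gcongr
        exacts [abs_ibpTerm_sub_sdTerm_le hN β Q e τ, abs_normProd_le_one Q ps, J_le Q]
      _ = _ := by ring
  have integral_error_le := norm_integral_le_of_norm_le_const (μ := gaugeMeasure Λ N β)
    (Eventually.of_forall error_le)
  rw [integral_sub (integrable_of_continuous (by fun_prop))
    (integrable_of_continuous (by fun_prop)), integral_eq_zero, zero_sub, norm_neg,
    integral_const_mul, probReal_univ, mul_one, Real.norm_eq_abs, abs_mul,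
    abs_of_pos (by positivity : (0 : ℝ) < 2 * N ^ 2)] at integral_error_le
  rw [le_div_iff₀ hN']
  refine le_of_mul_le_mul_left (a := 2 * (N : ℝ)) ?_ (by positivity)
  linarith

end SchwingerDyson

/-! ### Arcs of closed paths -/

section BeforeAfter

variable {a b ρ : List (Edge d)} {x y : ℕ}

theorem before_append_of_lt (h : y < a.length) : before (a ++ b) y = before a y :=
  List.take_append_of_le_length h.le

theorem after_append_of_lt (h : y < a.length) : after (a ++ b) y = after a y ++ b :=
  List.drop_append_of_le_length h

theorem before_append_length_add : before (a ++ b) (a.length + y) = a ++ before b y :=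
  List.take_length_add_append y

theorem after_append_length_add : after (a ++ b) (a.length + y) = after b y :=
  List.drop_length_add_append (y + 1)

theorem before_before (h : y < x) : before (before ρ x) y = before ρ y := by
  simp [before, List.take_take, h.le]

theorem before_after : before (after ρ x) y = between ρ x (x + 1 + y) := by
  simp only [before, after, between, List.take_drop]

theorem after_after : after (after ρ x) y = after ρ (x + 1 + y) := by
  simp only [after, List.drop_drop, add_assoc]

end BeforeAfter

/-- The edges of a closed path strictly between the locations `x` and `y`, in cyclic order; for
`x = y`, all edges but the one at `x`. -/
def arc (ρ : List (Edge d)) (x y : ℕ) : List (Edge d) :=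
  if x < y then between ρ x y else after ρ x ++ before ρ y

theorem isWalk_arc {ρ : List (Edge d)} (hρ : IsClosedPath ρ) {e f : Edge d} {x y : ℕ}
    (hx : ρ[x]? = some e) (hy : ρ[y]? = some f) : IsWalk e.tgt (arc ρ x y) f.src := by
  obtain ⟨u, hu⟩ := isClosedPath_iff.mp hρ
  unfold arc
  split_ifs with h
  · exact (hu.before hy).after (by rwa [before, List.getElem?_take_of_lt h])
  · exact isWalk_append.mpr ⟨u, hu.after hx, hu.before hy⟩

theorem sum_locs_arc_self {M : Type*} [AddCommMonoid M] {ρ : List (Edge d)} {e : Edge d} {x : ℕ}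
    (hx : ρ[x]? = some e) (f : Edge d) (G : List (Edge d) → List (Edge d) → M) :
    ∑ y ∈ locs (arc ρ x x) f, G (before (arc ρ x x) y) (after (arc ρ x x) y) =
      ∑ y ∈ (locs ρ f).erase x, G (arc ρ x y) (arc ρ y x) := by
  have lt_length {a : List (Edge d)} {y : ℕ} (hy : y ∈ locs a f) : y < a.length :=
    (List.getElem?_eq_some_iff.mp (mem_locs.mp hy)).1
  have hlen := length_before (List.getElem?_eq_some_iff.mp hx).1
  rw [sum_locs_erase hx, arc, if_neg (lt_irrefl x), sum_locs_append, add_comm]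
  congr 1
  · refine Finset.sum_congr rfl fun y hy => ?_
    have hyx : y < x := hlen ▸ lt_length hy
    rw [before_append_length_add, after_append_length_add, before_before hyx, arc,
      if_neg hyx.not_gt, arc, if_pos hyx]
    rfl
  · refine Finset.sum_congr rfl fun y hy => ?_
    have hxy : x < x + 1 + y := by lia
    rw [before_append_of_lt (lt_length hy), after_append_of_lt (lt_length hy), before_after,
      after_after, arc, if_pos hxy, arc, if_neg hxy.not_gt]

/-! ### Wilson loop variables of splittings and deformations -/

theorem wilson_core_append {a b : List (Edge d)} {u : Fin d → ℤ} (h : IsWalk u (b ++ a) u)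
    (Q : Config Λ N) : wilson Q (core (a ++ b)) = pathTrace Q (b ++ a) := by
  have h' : IsClosedPath (b ++ a) := isClosedPath_iff.mpr ⟨u, h⟩
  rw [pathTrace_append_comm, wilson_core]
  rwa [IsClosedPath, Cycle.coe_eq_coe.mpr List.isRotated_append]

theorem pathTrace_cons_arc_self {ρ : List (Edge d)} {e : Edge d} {x : ℕ} (hx : ρ[x]? = some e)
    (Q : Config Λ N) :
    pathTrace Q (e :: arc ρ x x) = pathTrace Q ρ := by
  rw [arc, if_neg (lt_irrefl x), ← List.cons_append, pathTrace_append_comm, ← eq_before_append hx]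

section Operations

variable {ρ : List (Edge d)} (hρ : IsClosedPath ρ) {e : Edge d} {x : ℕ} (hx : ρ[x]? = some e)

include hρ hx

theorem wilson_posSplit {y : ℕ} (hy : ρ[y]? = some e) (hxy : x ≠ y) (Q : Config Λ N) :
    wilson Q (posSplit ρ e x y).1 = pathTrace Q (e :: arc ρ y x) ∧
      wilson Q (posSplit ρ e x y).2 = pathTrace Q (e :: arc ρ x y) := by
  have closed_yx : IsWalk e.src (e :: arc ρ y x) e.src := ⟨rfl, isWalk_arc hρ hy hx⟩
  have closed_xy : IsWalk e.src (e :: arc ρ x y) e.src := ⟨rfl, isWalk_arc hρ hx hy⟩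
  unfold posSplit
  rcases hxy.lt_or_gt with h | h
  · simp only [arc, h, h.not_gt, if_true, if_false] at closed_yx closed_xy ⊢
    exact ⟨wilson_core_append (b := e :: _) closed_yx Q, wilson_core_append (b := [e]) closed_xy Q⟩
  · simp only [arc, h, h.not_gt, if_true, if_false] at closed_yx closed_xy ⊢
    exact ⟨wilson_core_append (b := [e]) closed_yx Q, wilson_core_append (b := e :: _) closed_xy Q⟩

theorem wilson_negSplit {y : ℕ} (hy : ρ[y]? = some e.inv) (Q : Config Λ N) :
    wilson Q (negSplit ρ x y).1 = pathTrace Q (arc ρ y x) ∧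
      wilson Q (negSplit ρ x y).2 = pathTrace Q (arc ρ x y) := by
  have hxy : x ≠ y := by
    rintro rfl
    exact e.ne_inv (Option.some.inj (hx.symm.trans hy))
  have closed_yx : IsWalk e.src (arc ρ y x) e.src := isWalk_arc hρ hy hx
  have closed_xy : IsWalk e.tgt (arc ρ x y) e.tgt := isWalk_arc hρ hx hy
  unfold negSplit
  rcases hxy.lt_or_gt with h | h
  · simp only [arc, h, h.not_gt, if_true, if_false] at closed_yx closed_xy ⊢
    exact ⟨wilson_core_append closed_yx Q, wilson_core (isClosedPath_iff.mpr ⟨_, closed_xy⟩) Q⟩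
  · simp only [arc, h, h.not_gt, if_true, if_false] at closed_yx closed_xy ⊢
    exact ⟨wilson_core (isClosedPath_iff.mpr ⟨_, closed_yx⟩) Q, wilson_core_append closed_xy Q⟩

theorem wilson_negDeform {p : List (Edge d)} (hp : p ∈ plaquettesAt e) (Q : Config Λ N) :
    wilson Q (negDeform ρ e x p) = pathTrace Q (arc ρ x x ++ invPath (staple e p)) := by
  have closed : IsWalk e.tgt (arc ρ x x ++ invPath (staple e p)) e.tgt :=
    isWalk_append.mpr ⟨_, isWalk_arc hρ hx hx, (isWalk_staple hp).invPath⟩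
  rw [arc, if_neg (lt_irrefl x), List.append_assoc] at closed ⊢
  rw [negDeform_eq, ← List.append_assoc]
  exact wilson_core_append closed Q

theorem wilson_posDeform {p : List (Edge d)} (hp : p ∈ plaquettesAt e) (Q : Config Λ N) :
    wilson Q (posDeform ρ e x p) = pathTrace Q (e :: arc ρ x x ++ e :: staple e p) := by
  have closed : IsWalk e.src (e :: arc ρ x x ++ e :: staple e p) e.src :=
    isWalk_append.mpr ⟨_, ⟨rfl, isWalk_arc hρ hx hx⟩, rfl, isWalk_staple hp⟩
  rw [arc, if_neg (lt_irrefl x), ← List.cons_append, List.append_assoc] at closed ⊢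
  rw [posDeform_eq, ← List.cons_append, ← List.append_assoc]
  exact wilson_core_append closed Q

end Operations

/-! ### The master loop equation at finite `N` -/

/-- The product of the normalized Wilson loop variables of a loop sequence, whose expectation is
`wilsonPhi`. -/
noncomputable def wilsonProd (Q : Config Λ N) (s : LoopSeq d) : ℝ :=
  (s.minRep.map fun l => wilson Q l / N).prod

theorem wilsonPhi_eq_integral_wilsonProd (β : ℝ) (s : LoopSeq d) :
    wilsonPhi Λ N β s = ∫ Q, wilsonProd Q s ∂(gaugeMeasure Λ N β) := by
  simp only [wilsonPhi, wilsonProd, div_eq_mul_inv, List.prod_map_mul, List.map_const',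
    List.prod_replicate, inv_pow, integral_mul_const]

theorem wilsonProd_null (Q : Config Λ N) : wilsonProd Q LoopSeq.null = 1 := by
  simp [wilsonProd, LoopSeq.minRep_null]

theorem wilsonProd_mk_cons (hN : 0 < N) (Q : Config Λ N) (l : Loop d) (ls : List (Loop d)) :
    wilsonProd Q (.mk (l :: ls)) = wilson Q l / N * wilsonProd Q (.mk ls) := by
  have null_eq_one : wilson Q Loop.null / N = (1 : ℝ) := by
    rw [wilson_null, div_self (Nat.cast_ne_zero.mpr hN.ne')]
  simp only [wilsonProd, LoopSeq.minRep_mk]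
  rw [prod_map_dropNull null_eq_one, prod_map_dropNull null_eq_one, List.map_cons,
    List.prod_cons]

theorem exists_wilsonProd_eq_normProd (s : LoopSeq d) :
    ∃ ps : List (List (Edge d)), ∀ (Λ : Finset (Fin d → ℤ)) (N : ℕ) (Q : Config Λ N),
      wilsonProd Q s = normProd Q ps := by
  choose path hpath using fun l : Loop d => l.exists_coe_eq
  refine ⟨s.minRep.map path, fun Λ N Q => ?_⟩
  simp only [wilsonProd, normProd, List.map_map, Function.comp_def, normTrace,
    wilson_eq (hpath _)]

@[fun_prop]
theorem continuous_wilsonProd (s : LoopSeq d) :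
    Continuous fun Q : Config Λ N => wilsonProd Q s := by
  obtain ⟨ps, hps⟩ := exists_wilsonProd_eq_normProd s
  simpa only [hps] using continuous_normProd ps

theorem abs_wilsonPhi_le_one (β : ℝ) (s : LoopSeq d) : |wilsonPhi Λ N β s| ≤ 1 := by
  obtain ⟨ps, hps⟩ := exists_wilsonProd_eq_normProd s
  have integral_le := norm_integral_le_of_norm_le_const (μ := gaugeMeasure Λ N β)
    (f := fun Q => normProd Q ps) (Eventually.of_forall fun Q => abs_normProd_le_one Q ps)
  simpa only [wilsonPhi_eq_integral_wilsonProd, hps, Real.norm_eq_abs, probReal_univ,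
    mul_one] using integral_le

theorem wilsonPhi_null (β : ℝ) : wilsonPhi Λ N β LoopSeq.null = 1 := by
  simp [wilsonPhi_eq_integral_wilsonProd, wilsonProd_null]

theorem integral_locTerm {Ω : Type*} [MeasurableSpace Ω] {μ : Measure Ω} {F : Ω → LoopSeq d → ℝ}
    (hF : ∀ s, Integrable (fun ω => F ω s) μ) (β : ℝ) (ρ : List (Edge d)) (e : Edge d)
    (ls : List (Loop d)) (x : ℕ) :
    ∫ ω, locTerm β (F ω) ρ e ls x ∂μ = locTerm β (fun s => ∫ ω, F ω s ∂μ) ρ e ls x := by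
  unfold locTerm
  rw [integral_add, integral_sub, integral_const_mul, integral_finsetSum, integral_finsetSum,
    integral_finsetSum]
  · simp only [integral_sub (hF _) (hF _)]
  all_goals fun_prop (disch := assumption)

section MasterLoop

variable {ρ : List (Edge d)} {e : Edge d} {x : ℕ} (hx : ρ[x]? = some e) (β : ℝ)
  (ls : List (Loop d))

include hx

section Pointwise

variable (hN : 0 < N) (Q : Config Λ N)

include hN

theorem sum_wilsonProd_negSplit (hρ : IsClosedPath ρ) :
    ∑ y ∈ locs ρ e.inv, wilsonProd Q (.mk ((negSplit ρ x y).1 :: (negSplit ρ x y).2 :: ls)) =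
      (∑ y ∈ locs (arc ρ x x) e.inv, normTrace Q (before (arc ρ x x) y) *
        normTrace Q (after (arc ρ x x) y)) * wilsonProd Q (.mk ls) := by
  have hx_notMem : x ∉ locs ρ e.inv := fun h =>
    e.ne_inv (Option.some.inj (hx.symm.trans (mem_locs.mp h)))
  rw [sum_locs_arc_self hx e.inv fun a b => normTrace Q a * normTrace Q b,
    Finset.erase_eq_of_notMem hx_notMem, Finset.sum_mul]
  refine Finset.sum_congr rfl fun y hy => ?_
  obtain ⟨h₁, h₂⟩ := wilson_negSplit hρ hx (mem_locs.mp hy) Q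
  rw [wilsonProd_mk_cons hN, wilsonProd_mk_cons hN, h₁, h₂, normTrace, normTrace]
  ring

theorem sum_wilsonProd_posSplit (hρ : IsClosedPath ρ) :
    ∑ y ∈ (locs ρ e).erase x,
        wilsonProd Q (.mk ((posSplit ρ e x y).1 :: (posSplit ρ e x y).2 :: ls)) =
      (∑ y ∈ locs (arc ρ x x) e, normTrace Q (e :: before (arc ρ x x) y) *
        normTrace Q (e :: after (arc ρ x x) y)) * wilsonProd Q (.mk ls) := by
  rw [sum_locs_arc_self hx e fun a b => normTrace Q (e :: a) * normTrace Q (e :: b),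
    Finset.sum_mul]
  refine Finset.sum_congr rfl fun y hy => ?_
  obtain ⟨hyx, hy⟩ := Finset.mem_erase.mp hy
  obtain ⟨h₁, h₂⟩ := wilson_posSplit hρ hx (mem_locs.mp hy) hyx.symm Q
  rw [wilsonProd_mk_cons hN, wilsonProd_mk_cons hN, h₁, h₂, normTrace, normTrace]
  ring

theorem sum_wilsonProd_deform (hρ : IsClosedPath ρ) :
    ∑ p ∈ plaquettesAt e, (wilsonProd Q (.mk (negDeform ρ e x p :: ls)) -
        wilsonProd Q (.mk (posDeform ρ e x p :: ls))) =
      (∑ p ∈ plaquettesAt e, (normTrace Q (arc ρ x x ++ invPath (staple e p)) -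
        normTrace Q (e :: arc ρ x x ++ e :: staple e p))) * wilsonProd Q (.mk ls) := by
  rw [Finset.sum_mul]
  refine Finset.sum_congr rfl fun p hp => ?_
  rw [wilsonProd_mk_cons hN, wilsonProd_mk_cons hN, wilson_negDeform hρ hx hp,
    wilson_posDeform hρ hx hp, normTrace, normTrace, sub_mul]

theorem locTerm_wilsonProd_sub {l₁ : Loop d} (hl : (ρ : Cycle (Edge d)) = l₁.1) :
    locTerm β (wilsonProd Q) ρ e ls x - wilsonProd Q (.mk (l₁ :: ls)) =
      sdTerm β Q e (arc ρ x x) * wilsonProd Q (.mk ls) := by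
  have hρ := Loop.isClosedPath hl
  rw [locTerm, sum_wilsonProd_negSplit hx ls hN Q hρ, sum_wilsonProd_posSplit hx ls hN Q hρ,
    sum_wilsonProd_deform hx ls hN Q hρ, wilsonProd_mk_cons hN, wilson_eq hl,
    ← pathTrace_cons_arc_self hx, sdTerm, ← normTrace]
  ring

end Pointwise

theorem exists_abs_locTerm_wilsonPhi_sub_le {l₁ : Loop d} (hl : (ρ : Cycle (Edge d)) = l₁.1) :
    ∃ C : ℝ, ∀ (Λ : Finset (Fin d → ℤ)) (N : ℕ), 0 < N → e.src ∈ Λ → e.tgt ∈ Λ →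
      plaquettesAt e ⊆ plaquettesIn Λ →
        |locTerm β (wilsonPhi Λ N β) ρ e ls x - wilsonPhi Λ N β (.mk (l₁ :: ls))| ≤ C / N := by
  obtain ⟨ps, hps⟩ := exists_wilsonProd_eq_normProd (.mk ls)
  refine ⟨2 * ((arc ρ x x).length + 1) + 4 * (ps.map List.length).sum,
    fun Λ N hN hsrc htgt hΛ => ?_⟩
  have h := abs_integral_sdTerm_mul_normProd_le hsrc htgt hΛ β (arc ρ x x) ps hN
  have integrable_wilsonProd (s : LoopSeq d) :
      Integrable (fun Q => wilsonProd Q s) (gaugeMeasure Λ N β) :=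
    integrable_of_continuous (continuous_wilsonProd s)
  have integrable_locTerm : Integrable (fun Q => locTerm β (wilsonProd Q) ρ e ls x)
      (gaugeMeasure Λ N β) := integrable_of_continuous (by unfold locTerm; fun_prop)
  simp only [← hps, ← locTerm_wilsonProd_sub hx β ls hN _ hl] at h
  rw [integral_sub integrable_locTerm (integrable_wilsonProd _),
    integral_locTerm integrable_wilsonProd] at h
  simpa only [← wilsonPhi_eq_integral_wilsonProd] using h

end MasterLoop

end GaugeTheory

/-! ### The 't Hooft limit -/

theorem tendsto_locTerm {ι : Type*} {F : Filter ι} {f : ι → LoopSeq d → ℝ} {φ : LoopSeq d → ℝ}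
    (h : ∀ s, Tendsto (fun n => f n s) F (𝓝 (φ s))) (β : ℝ) (ρ : List (Edge d)) (e : Edge d)
    (ls : List (Loop d)) (x : ℕ) :
    Tendsto (fun n => locTerm β (f n) ρ e ls x) F (𝓝 (locTerm β φ ρ e ls x)) :=
  ((tendsto_finsetSum _ fun _ _ => h _).sub (tendsto_finsetSum _ fun _ _ => h _)).add
    ((tendsto_finsetSum _ fun _ _ => (h _).sub (h _)).const_mul β)

theorem masterLoopEq_of_locTerm_eq {R : FirstEdgeRule d} {β : ℝ} {φ : LoopSeq d → ℝ}
    (h : ∀ (l : Loop d) (ls : List (Loop d)) (e : Edge d), ∀ x ∈ locs (R.path l) e,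
      locTerm β φ (R.path l) e ls x = φ (.mk (l :: ls))) : MasterLoopEq R β φ := by
  intro s l ls hs e τ _
  rw [← sum_locTerm_add_sum_locTerm_inv, Finset.sum_congr rfl (h l ls e),
    Finset.sum_congr rfl (h l ls e.inv), Finset.sum_const, Finset.sum_const, ← add_nsmul,
    ← Finset.card_union_of_disjoint (disjoint_locs_inv _ e), nsmul_eq_mul, ← hs,
    LoopSeq.mk_minRep]

section Exhaustion

variable {Λ : ℕ → Finset (Fin d → ℤ)} (hmono : Monotone Λ) (hΛ : ∀ x, ∃ N, x ∈ Λ N)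

include hmono hΛ

theorem eventually_mem (x : Fin d → ℤ) : ∀ᶠ N in atTop, x ∈ Λ N := by
  obtain ⟨n, hn⟩ := hΛ x
  exact (eventually_ge_atTop n).mono fun N hN => hmono hN hn

theorem eventually_plaquettesAt_subset (e : Edge d) :
    ∀ᶠ N in atTop, plaquettesAt e ⊆ plaquettesIn (Λ N) := by
  have vertices_mem (p : List (Edge d)) : ∀ᶠ N in atTop, ∀ f ∈ p, f.src ∈ Λ N ∧ f.tgt ∈ Λ N :=
    (List.finite_toSet p).eventually_all.mpr fun f _ =>
      (eventually_mem hmono hΛ f.src).and (eventually_mem hmono hΛ f.tgt)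
  filter_upwards [(Finset.eventually_all (plaquettesAt e)).mpr fun p _ => vertices_mem p]
    with N hN p hp
  exact mem_plaquettesIn.mpr ⟨(mem_plaquettesAt.mp hp).1, hN p hp⟩

theorem isMasterSolution_of_tendsto_wilsonPhi {F : Filter ℕ} [F.NeBot] (hF : F ≤ atTop) {β : ℝ}
    {φ : LoopSeq d → ℝ} (hφ : ∀ s, Tendsto (fun N => wilsonPhi (Λ N) N β s) F (𝓝 (φ s)))
    (R : FirstEdgeRule d) : IsMasterSolution R 1 β φ where
  null := tendsto_nhds_unique (hφ _) (by simp only [wilsonPhi_null, tendsto_const_nhds])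
  bound s := by
    rw [one_pow]
    exact le_of_tendsto (hφ s).abs (Eventually.of_forall fun N => abs_wilsonPhi_le_one β s)
  master := masterLoopEq_of_locTerm_eq fun l ls e x hx => by
    obtain ⟨C, hC⟩ := exists_abs_locTerm_wilsonPhi_sub_le (mem_locs.mp hx) β ls (R.path_mem l)
    refine sub_eq_zero.mp (tendsto_nhds_unique ((tendsto_locTerm hφ β _ e ls x).sub (hφ _))
      (squeeze_zero_norm' ?_ ((tendsto_const_div_atTop_nhds_zero_nat C).mono_left hF)))
    filter_upwards [hF (eventually_gt_atTop 0), hF (eventually_mem hmono hΛ e.src),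
      hF (eventually_mem hmono hΛ e.tgt), hF (eventually_plaquettesAt_subset hmono hΛ e)]
      with N hN hsrc htgt hplaq
    exact hC (Λ N) N hN hsrc htgt hplaq

end Exhaustion

theorem exists_tendsto_wilsonPhi (Λ : ℕ → Finset (Fin d → ℤ)) (β : ℝ) (U : Ultrafilter ℕ) :
    ∃ φ : LoopSeq d → ℝ, ∀ s, Tendsto (fun N => wilsonPhi (Λ N) N β s) U (𝓝 (φ s)) := by
  have pointwise (s : LoopSeq d) : ∃ a, Tendsto (fun N => wilsonPhi (Λ N) N β s) U (𝓝 a) := by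
    have mem_Icc : Set.Icc (-1 : ℝ) 1 ∈ U.map fun N => wilsonPhi (Λ N) N β s :=
      Ultrafilter.mem_map.mpr (Eventually.of_forall fun N => abs_le.mp (abs_wilsonPhi_le_one β s))
    obtain ⟨a, -, ha⟩ := isCompact_Icc.ultrafilter_le_nhds _ (le_principal_iff.mpr mem_Icc)
    exact ⟨a, ha⟩
  choose φ hφ using pointwise
  exact ⟨φ, hφ⟩

theorem exists_forall_isMasterSolution (d : ℕ) (β : ℝ) :
    ∃ φ : LoopSeq d → ℝ, ∀ R : FirstEdgeRule d, IsMasterSolution R 1 β φ := by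
  obtain ⟨Λ, hmono, htop⟩ := exists_seq_monotone_tendsto_atTop_atTop (Finset (Fin d → ℤ))
  have hΛ (x : Fin d → ℤ) : ∃ N, x ∈ Λ N := by
    simpa only [Finset.singleton_subset_iff] using (htop.eventually_ge_atTop {x}).exists
  obtain ⟨φ, hφ⟩ := exists_tendsto_wilsonPhi Λ β (hyperfilter ℕ)
  exact ⟨φ, isMasterSolution_of_tendsto_wilsonPhi hmono hΛ Nat.hyperfilter_le_atTop hφ⟩

theorem nonempty_firstEdgeRule (d : ℕ) : Nonempty (FirstEdgeRule d) :=
  ⟨⟨fun l => Quotient.out l.1, fun _ => Quotient.out_eq _⟩⟩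

theorem IsMasterSolution.mono {R : FirstEdgeRule d} {β L L' : ℝ} {φ : LoopSeq d → ℝ}
    (h : IsMasterSolution R L β φ) (hL : 0 ≤ L) (hLL' : L ≤ L') : IsMasterSolution R L' β φ where
  null := h.null
  bound s := (h.bound s).trans (pow_le_pow_left₀ hL hLL' _)
  master := h.master

end LatticeGauge

theorem mainTheorem4 (d : ℕ) (hd : 2 ≤ d) :
    (∀ L : ℝ, 1 ≤ L → ∃ β₀ : ℝ, 0 < β₀ ∧ ∀ β : ℝ, |β| ≤ β₀ →
      ∀ R : FirstEdgeRule d, ∃! φ : LoopSeq d → ℝ, IsMasterSolution R L β φ) ∧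
    (∃ β₀ : ℝ, 0 < β₀ ∧ ∀ β : ℝ, |β| ≤ β₀ →
      ∃ φ : LoopSeq d → ℝ, (∀ R : FirstEdgeRule d, IsMasterSolution R 1 β φ) ∧
        ∀ Λ : ℕ → Finset (Fin d → ℤ), Monotone Λ → (∀ x, ∃ N, x ∈ Λ N) →
          ∀ s : LoopSeq d, Tendsto (fun N => wilsonPhi (Λ N) N β s) atTop (𝓝 (φ s))) := by
  constructor
  · intro L hL
    obtain ⟨β₀, hβ₀, unique⟩ := exists_beta_forall_isMasterSolution_eq d hL
    refine ⟨β₀, hβ₀, fun β hβ R => ?_⟩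
    obtain ⟨φ, hφ⟩ := exists_forall_isMasterSolution d β
    have hφL := (hφ R).mono zero_le_one hL
    exact ⟨φ, hφL, fun ψ hψ => unique β hβ R ψ φ hψ hφL⟩
  · obtain ⟨β₀, hβ₀, unique⟩ := exists_beta_forall_isMasterSolution_eq d le_rfl
    obtain ⟨R⟩ := nonempty_firstEdgeRule d
    refine ⟨β₀, hβ₀, fun β hβ => ?_⟩
    obtain ⟨φ, hφ⟩ := exists_forall_isMasterSolution d β
    refine ⟨φ, hφ, fun Λ hmono hΛ s => (tendsto_iff_ultrafilter _ _ _).mpr fun U hU => ?_⟩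
    obtain ⟨ψ, hψ⟩ := exists_tendsto_wilsonPhi Λ β U
    have hψ_sol := isMasterSolution_of_tendsto_wilsonPhi hmono hΛ hU hψ R
    rw [unique β hβ R φ ψ (hφ R) hψ_sol]
    exact hψ s
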